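/- All curves are open simple plane curves: a simple curve is a set $C\subseteq\mathbb R^2$ that is the range of an injective continuous map $[0,1]\to\mathbb R^2$. Its length $l(C)\in[0,\infty]$ is the supremum of the Euclidean lengths $\sum_{i<n}|g(a_i)-g(a_{i+1})|$ over all partitions $0=a_0<\dots<a_n=1$, for any injective continuous parametrization $g$ of $C$ (it does not depend on $g$); a single point has length $0$. A name of a real $x$ is a sequence of rationals $(q_n)$ with $|q_n-x|\le 2^{-n}$ for all $n$; $x$ is computable if it has a computable name. A function $[0,1]\to\mathbb R$ is computable if some Turing machine transforms every name of every $x\in[0,1]$ into a name of the value at $x$; a function $[0,1]\to\mathbb R^2$ is computable if both its components are. For $\varepsilon>0$ let $V_\varepsilon(z)$ be the open axis-parallel square with centre $z\in\mathbb R^2$ and side length $2\varepsilon$, called a rational neighborhood if $\varepsilon$ and both coordinates of $z$ are rational; put $V_\varepsilon(A)=\bigcup_{z\in A}V_\varepsilon(z)$ and $d_H(A,B)=\inf\{\varepsilon>0: A\subseteq V_\varepsilon(B)\text{ and }B\subseteq V_\varepsilon(A)\}$. A simple curve $C$ is $K$-computable if there is a computable sequence $(Q_n)_{n\in\mathbb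 N}$ of finite sets of rational neighborhoods such that $C\subseteq\bigcup Q_n$ and $d_H(\bigcup Q_n,C)<2^{-n}$ for all $n\in\mathbb N$. A simple curve $C$ is $N$-computable if $l(C)<\infty$ and there is a computable (hence continuous) function $f:[0,1]\to\mathbb R^2$ with range $C$ such that the segment $f([0,t])$ has length $t\cdot l(C)$ for all $t\in[0,1]$. **Theorem.** Let $C\subseteq\mathbb R^2$ be a $K$-computable simple curve whose length $l(C)$ is finite and is a computable real number. Then $C$ is $N$-computable. -/

import Mathlib

namespace ComputableCurve

/-! ### Computable reals and computable real functions -/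

/-- Codes of rational numbers: the pair `(p, q)` stands for the fraction `p / (q + 1)`. -/
abbrev RatCode : Type := ℤ × ℕ

/-- The real number denoted by a code of a rational number. -/
noncomputable def RatCode.val (c : RatCode) : ℝ := (c.1 : ℝ) / ((c.2 : ℝ) + 1)

/-- A name of a real number `x` is a sequence of (codes of) rationals that converges to `x` with
error at most `2⁻ⁿ` at the `n`-th term. -/
def IsName (α : ℕ → RatCode) (x : ℝ) : Prop :=
  ∀ n : ℕ, |RatCode.val (α n) - x| ≤ 1 / 2 ^ n

/-- A real number is computable if it has a computable name. -/
def IsComputableReal (x : ℝ) : Prop :=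
  ∃ α : ℕ → RatCode, Computable α ∧ IsName α x

/-- A machine that transforms infinite sequences into infinite sequences is described by its step
function `M`: `M w n` is the `n`-th output term if the machine has produced that term after
`w.length` steps, having read no more of its input than the finite initial part `w`, and is `none`
if the term has not been produced by then. `Produces M α n q` says that `q` is the `n`-th term which
the machine produces on the infinite input `α`, that is, the first answer which it gives when it
sees longer and longer initial parts of `α`. -/
def Produces (M : List RatCode → ℕ → Option RatCode) (α : ℕ → RatCode) (n : ℕ)
    (q : RatCode) : Prop :=
  ∃ k : ℕ, M ((List.range k).map α) n = some q ∧ ∀ j < k, M ((List.range j).map α) n = none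

/-- A function `f : [0,1] → ℝ` is computable if some machine transforms every name of every
`x ∈ [0,1]` into a name of `f x`. -/
def IsComputableFun (f : unitInterval → ℝ) : Prop :=
  ∃ M : List RatCode → ℕ → Option RatCode, Computable₂ M ∧
    ∀ (x : unitInterval) (α : ℕ → RatCode), IsName α (x : ℝ) →
      ∃ β : ℕ → RatCode, IsName β (f x) ∧ ∀ n : ℕ, Produces M α n (β n)

/-! ### Simple plane curves and their lengths -/

/-- The Euclidean plane. -/
abbrev Plane : Type := EuclideanSpace ℝ (Fin 2)

/-- A function `f : [0,1] → ℝ²` is computable if both of its component functions are. -/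
def IsComputablePlaneFun (f : unitInterval → Plane) : Prop :=
  ∀ i : Fin 2, IsComputableFun fun t => f t i

/-- `f : [0,1] → ℝ²` is a parametrization of the set `C`. -/
def IsParametrization (f : unitInterval → Plane) (C : Set Plane) : Prop :=
  Continuous f ∧ Set.range f = C

/-- A simple (open) plane curve, i.e. a Jordan arc. -/
def IsSimpleCurve (C : Set Plane) : Prop :=
  ∃ f : unitInterval → Plane, IsParametrization f C ∧ Function.Injective f

/-- The length of a simple curve: the length (total variation, i.e. the supremum of the lengths of
inscribed polygons) of an injective parametrization. All injective parametrizations of a simple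
curve have the same length, and the supremum picks this common value. A one-point set, which
occurs as a degenerate segment of a curve, has no injective parametrization and gets length `0`. -/
noncomputable def curveLength (C : Set Plane) : ENNReal :=
  ⨆ (f : unitInterval → Plane) (_ : IsParametrization f C ∧ Function.Injective f),
    eVariationOn f Set.univ

/-! ### Square neighbourhoods and the Hausdorff distance -/

/-- The `ε`-neighbourhood of a point: the open square bounded by the lines `x = z₀ ± ε` and
`y = z₁ ± ε`. -/
def squareNhd (ε : ℝ) (z : Plane) : Set Plane :=
  {w | |w 0 - z 0| < ε ∧ |w 1 - z 1| < ε}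

/-- The `ε`-neighbourhood of a set. -/
def setNhd (ε : ℝ) (A : Set Plane) : Set Plane := ⋃ z ∈ A, squareNhd ε z

/-- The Hausdorff distance with respect to square neighbourhoods: the infimum of all `ε > 0` with
`A ⊆ V_ε(B)` and `B ⊆ V_ε(A)` (and `∞` if there is no such `ε`). -/
noncomputable def hausdorffDistance (A B : Set Plane) : ENNReal :=
  ⨅ (ε : ℝ) (_ : 0 < ε ∧ A ⊆ setNhd ε B ∧ B ⊆ setNhd ε A), ENNReal.ofReal ε

/-- Codes of rational neighbourhoods: the codes of the two coordinates of the centre, and the code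
of the radius. -/
abbrev NhdCode : Type := (RatCode × RatCode) × RatCode

/-- The neighbourhood denoted by a code. -/
noncomputable def NhdCode.nhd (c : NhdCode) : Set Plane :=
  squareNhd (RatCode.val c.2) !₂[RatCode.val c.1.1, RatCode.val c.1.2]

/-- The union of a finite list of coded neighbourhoods. -/
noncomputable def coverUnion (Q : List NhdCode) : Set Plane := ⋃ c ∈ Q, NhdCode.nhd c

/-! ### K-computable and N-computable curves -/

/-- `C` is `K`-computable: there is a computable sequence of finite sets of rational
neighbourhoods which cover `C` and whose unions converge to `C` effectively. -/
def KComputable (C : Set Plane) : Prop :=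
  ∃ Q : ℕ → List NhdCode, Computable Q ∧
    ∀ n : ℕ, (∀ c ∈ Q n, 0 < RatCode.val c.2) ∧
      C ⊆ coverUnion (Q n) ∧
      hausdorffDistance (coverUnion (Q n)) C < ENNReal.ofReal (1 / 2 ^ n)

/-- `C` has a computable length: it is rectifiable and its length is a computable real. -/
def HasComputableLength (C : Set Plane) : Prop :=
  curveLength C ≠ ⊤ ∧ IsComputableReal (curveLength C).toReal

/-- `C` is `N`-computable: `C` is rectifiable and has a computable parametrization `f` such that
the segment `f([0,t])` has length `t · l(C)` for all `t ∈ [0,1]`. -/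
def NComputable (C : Set Plane) : Prop :=
  curveLength C ≠ ⊤ ∧
    ∃ f : unitInterval → Plane, IsParametrization f C ∧ IsComputablePlaneFun f ∧
      ∀ t : unitInterval,
        curveLength (f '' Set.Icc 0 t) = ENNReal.ofReal (t : ℝ) * curveLength C

end ComputableCurve

/-!
A rectifiable arc `C` of length `L` has an injective parametrization `g` of constant speed `L`,
obtained by inverting its normalized arc length (`exists_hasConstantSpeed`). It is rigid: an
`L`-Lipschitz map `h : [0,1] → ℝ²` onto `C` is `g` or its reverse (`eq_of_dist_le_of_range_eq`).
Indeed the first times at which `h` reaches the points `g u` increase with `u`, and between `u` and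
`v` they leave at least the time `v - u`, since `h` needs at least this time to cover the length
`L * (v - u)`; as only the time `1` is available, the point `g u` is reached at the time `u`. By
compactness, a path with speed at most about `L` which stays near `C`, comes near every point of
`C`, and does not run backwards is uniformly close to `g` (`exists_forall_isNearParametrization`);
the direction is tested by comparing one coordinate of the two end points, chosen such that the end
points of `g` differ in it.

These conditions can be tested at a finite scale. The approximations of `C` by unions of squares
give, for each scale, a finite list of grid points near `C` (`gridCover`), and the name of `L`
bounds the admissible steps. The finitely many polygonal paths through these grid points which pass
the test (`candidates`) include the sampled and rounded `g` (`sampling_mem_candidates`), and for a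
fine scale all of them are close to `g` (`isNearParametrization_of_mem_candidates`). To compute
`g x`, the machine `arcMachine` waits for a scale at which all candidate paths agree, up to the
required precision, at a time near `x`, and returns the value of one of them. As the rounded `g` is
a candidate, the answer is correct even though no rate of convergence is known
(`arcMachine_sound`), and the compactness result shows that such a scale exists
(`arcMachine_complete`). The search at one stage is primitive recursive in the data of that stage.
-/

namespace ComputableCurve

open Set unitInterval Filter Topology

/-! ### The length of an arc and its constant-speed parametrization -/

theorem exists_lift_of_range_subset {f g : I → Plane} (hf : Continuous f)
    (hg : Continuous g) (hgi : Function.Injective g) (hfg : range f ⊆ range g) :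
    ∃ φ : I → I, Continuous φ ∧ ∀ t, g (φ t) = f t := by
  have he : Topology.IsEmbedding g := (hg.isClosedEmbedding hgi).isEmbedding
  refine ⟨fun t => he.toHomeomorph.symm ⟨f t, hfg ⟨t, rfl⟩⟩, ?_, fun t => ?_⟩
  · exact he.toHomeomorph.symm.continuous.comp (hf.subtype_mk _)
  · have := he.toHomeomorph.apply_symm_apply ⟨f t, hfg ⟨t, rfl⟩⟩
    exact congrArg Subtype.val this

theorem eVariationOn_eq_of_range_eq {f g : I → Plane} (hf : Continuous f)
    (hfi : Function.Injective f) (hg : Continuous g) (hgi : Function.Injective g)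
    (hfg : range f = range g) : eVariationOn f univ = eVariationOn g univ := by
  obtain ⟨φ, hφ, h⟩ := exists_lift_of_range_subset hf hg hgi hfg.le
  have hcomp : g ∘ φ = f := funext h
  have hφi : Function.Injective φ := by
    apply Function.Injective.of_comp (f := g); rwa [hcomp]
  have hφs : φ '' univ = univ := by
    rw [image_univ]
    refine eq_univ_of_forall fun u => ?_
    obtain ⟨t, ht⟩ : g u ∈ range f := hfg ▸ mem_range_self u
    exact ⟨t, hgi ((h t).trans ht)⟩
  rw [← hcomp]
  rcases hφ.strictMono_of_inj hφi with hm | ha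
  · rw [eVariationOn.comp_eq_of_monotoneOn g φ (hm.monotone.monotoneOn _), hφs]
  · rw [eVariationOn.comp_eq_of_antitoneOn g φ (ha.antitone.antitoneOn _), hφs]

theorem curveLength_eq {f : I → Plane} {C : Set Plane} (hf : IsParametrization f C)
    (hfi : Function.Injective f) : curveLength C = eVariationOn f univ := by
  refine le_antisymm (iSup₂_le fun g hg => ?_) (le_iSup₂_of_le f ⟨hf, hfi⟩ le_rfl)
  exact (eVariationOn_eq_of_range_eq hg.1.1 hg.2 hf.1 hfi (hg.1.2.trans hf.2.symm)).le

theorem curveLength_singleton (z : Plane) : curveLength {z} = 0 := by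
  refine le_antisymm (iSup₂_le fun g hg => ?_) bot_le
  have h0 : g 0 = z := by
    have : g 0 ∈ ({z} : Set Plane) := hg.1.2 ▸ mem_range_self 0
    exact this
  have h1 : g 1 = z := by
    have : g 1 ∈ ({z} : Set Plane) := hg.1.2 ▸ mem_range_self 1
    exact this
  exact absurd (hg.2 (h0.trans h1.symm)) zero_ne_one

/-- `g` runs along its range with constant speed `L`: over each subinterval of `[0,1]` its
variation is `L` times the length of the subinterval. -/
def HasConstantSpeed (g : I → Plane) (L : ℝ) : Prop :=
  ∀ s t : I, s ≤ t → eVariationOn g (Icc s t) = ENNReal.ofReal (L * (t - s))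

theorem HasConstantSpeed.dist_le {g : I → Plane} {L : ℝ} (hL : 0 ≤ L)
    (hg : HasConstantSpeed g L) (s t : I) : dist (g s) (g t) ≤ L * |(s : ℝ) - t| := by
  wlog hst : s ≤ t generalizing s t
  · rw [dist_comm, abs_sub_comm]; exact this t s (le_of_not_ge hst)
  have h := eVariationOn.edist_le g (left_mem_Icc.2 hst) (right_mem_Icc.2 hst)
  have hst' : (s : ℝ) ≤ t := hst
  rw [hg s t hst, edist_dist] at h
  rw [abs_sub_comm, abs_of_nonneg (sub_nonneg.2 hst')]
  exact (ENNReal.ofReal_le_ofReal_iff (mul_nonneg hL (sub_nonneg.2 hst'))).1 h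

theorem HasConstantSpeed.continuous {g : I → Plane} {L : ℝ} (hL : 0 ≤ L)
    (hg : HasConstantSpeed g L) : Continuous g := by
  have : LipschitzWith L.toNNReal g := LipschitzWith.of_dist_le_mul fun s t => by
    rw [Real.coe_toNNReal L hL, Subtype.dist_eq, Real.dist_eq]
    exact hg.dist_le hL s t
  exact this.continuous

theorem HasConstantSpeed.comp_symm {g : I → Plane} {L : ℝ} (hg : HasConstantSpeed g L) :
    HasConstantSpeed (g ∘ σ) L := by
  intro s t hst
  have hanti : Antitone σ := fun a b hab => symm_le_symm.2 hab
  have himg : σ '' Icc s t = Icc (σ t) (σ s) := by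
    ext u
    constructor
    · rintro ⟨v, ⟨h1, h2⟩, rfl⟩
      exact ⟨symm_le_symm.2 h2, symm_le_symm.2 h1⟩
    · rintro ⟨h1, h2⟩
      refine ⟨σ u, ⟨?_, ?_⟩, symm_symm u⟩
      · rw [← symm_symm s]; exact symm_le_symm.2 h2
      · rw [← symm_symm t]; exact symm_le_symm.2 h1
  rw [eVariationOn.comp_eq_of_antitoneOn g σ (hanti.antitoneOn _), himg,
    hg _ _ (symm_le_symm.2 hst), coe_symm_eq, coe_symm_eq]
  congr 1; ring

/-- A rectifiable arc has an injective parametrization of constant speed: the inverse of the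
normalized arc length function reparametrizes any injective parametrization. -/
theorem exists_hasConstantSpeed {f : I → Plane} (hf : Continuous f)
    (hfi : Function.Injective f) (hfin : eVariationOn f univ ≠ ⊤) :
    ∃ g : I → Plane, Function.Injective g ∧ range g = range f ∧
      0 < (eVariationOn f univ).toReal ∧ HasConstantSpeed g (eVariationOn f univ).toReal := by
  set L := (eVariationOn f univ).toReal with hLdef
  have hbv : BoundedVariationOn f univ := hfin
  have hloc : LocallyBoundedVariationOn f univ := hbv.locallyBoundedVariationOn
  set v : I → ℝ := variationOnFromTo f univ 0 with hv
  have hvle : ∀ s t : I, s ≤ t → v t - v s = (eVariationOn f (Icc s t)).toReal := by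
    intro s t hst
    rw [hv, variationOnFromTo.sub_right hloc (mem_univ _) (mem_univ _) (mem_univ _),
      variationOnFromTo.eq_of_le _ _ hst, univ_inter]
  have hvs : StrictMono v := by
    intro s t hst
    rw [← sub_pos, hvle s t hst.le, ENNReal.toReal_pos_iff]
    refine ⟨?_, (eVariationOn.mono f (subset_univ _)).trans_lt hfin.lt_top⟩
    refine lt_of_lt_of_le ?_
      (eVariationOn.edist_le f (left_mem_Icc.2 hst.le) (right_mem_Icc.2 hst.le))
    exact edist_pos.2 (hfi.ne hst.ne)
  have hv0 : v 0 = 0 := variationOnFromTo.self f univ 0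
  have hv1 : v 1 = L := by
    have := hvle 0 1 zero_le_one
    rw [hv0, sub_zero] at this
    rw [this, hLdef]
    congr 2
    exact eq_univ_of_forall fun t => ⟨t.2.1, t.2.2⟩
  have hLpos : 0 < L := by rw [← hv1, ← hv0]; exact hvs zero_lt_one
  have hvc : Continuous v := by
    rw [continuous_iff_continuousAt]
    intro x
    rw [continuousAt_iff_continuous_left'_right']
    constructor
    · have h := variationOnFromTo.tendsto_left (mem_univ (0 : I)) (mem_univ x) hloc
        (l := f x) (hf.continuousAt.tendsto.mono_left nhdsWithin_le_nhds)
      simpa [ContinuousWithinAt] using h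
    · have h := variationOnFromTo.tendsto_right (mem_univ (0 : I)) (mem_univ x) hloc
        (l := f x) (hf.continuousAt.tendsto.mono_left nhdsWithin_le_nhds)
      simpa [ContinuousWithinAt] using h
  have hsurj : ∀ u : I, ∃ t : I, v t = L * u := by
    intro u
    have : L * (u : ℝ) ∈ Icc (v 0) (v 1) := by
      rw [hv0, hv1]
      exact ⟨mul_nonneg hLpos.le u.2.1, mul_le_of_le_one_right hLpos.le u.2.2⟩
    obtain ⟨t, -, ht⟩ := intermediate_value_Icc zero_le_one hvc.continuousOn this
    exact ⟨t, ht⟩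
  choose τ hτ using hsurj
  have hτm : StrictMono τ := by
    intro a b hab
    rw [← hvs.lt_iff_lt, hτ, hτ]
    exact mul_lt_mul_of_pos_left hab hLpos
  have hτs : Function.Surjective τ := by
    intro t
    have h1 : 0 ≤ v t := hv0 ▸ hvs.monotone t.2.1
    have h2 : v t ≤ L := hv1 ▸ hvs.monotone t.2.2
    refine ⟨⟨v t / L, div_nonneg h1 hLpos.le, (div_le_one hLpos).2 h2⟩, hvs.injective ?_⟩
    rw [hτ]
    exact mul_div_cancel₀ _ hLpos.ne'
  refine ⟨f ∘ τ, hfi.comp hτm.injective, hτs.range_comp f, hLpos, fun s t hst => ?_⟩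
  have himg : τ '' Icc s t = Icc (τ s) (τ t) := by
    ext u
    constructor
    · rintro ⟨w, ⟨h1, h2⟩, rfl⟩
      exact ⟨hτm.monotone h1, hτm.monotone h2⟩
    · obtain ⟨w, rfl⟩ := hτs u
      rintro ⟨h1, h2⟩
      exact ⟨w, ⟨hτm.le_iff_le.1 h1, hτm.le_iff_le.1 h2⟩, rfl⟩
  rw [eVariationOn.comp_eq_of_monotoneOn f τ (hτm.monotone.monotoneOn _), himg,
    ← ENNReal.ofReal_toReal (ne_top_of_le_ne_top hfin (eVariationOn.mono f (subset_univ _))),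
    ← hvle _ _ (hτm.monotone hst), hτ, hτ, mul_sub]

/-- The initial segments of an arc with constant speed `L` have the expected lengths. -/
theorem HasConstantSpeed.curveLength_image {g : I → Plane} {L : ℝ} (hL : 0 ≤ L)
    (hg : HasConstantSpeed g L) (hgi : Function.Injective g) (t : I) :
    curveLength (g '' Icc 0 t) = ENNReal.ofReal (L * t) := by
  rcases eq_or_lt_of_le (show (0 : I) ≤ t from t.2.1) with rfl | ht
  · simp [curveLength_singleton]
  have ht' : (0 : ℝ) < t := ht
  set m : I → I := fun s => t * s with hm
  have hmm : StrictMono m := fun a b hab => mul_lt_mul_of_pos_left (show (a : ℝ) < b from hab) ht'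
  have hmi : m '' univ = Icc 0 t := by
    ext u
    constructor
    · rintro ⟨s, -, rfl⟩
      exact ⟨(t * s).2.1, mul_le_of_le_one_right t.2.1 s.2.2⟩
    · rintro ⟨h1, h2⟩
      refine ⟨⟨(u : ℝ) / t, div_nonneg h1 ht'.le, (div_le_one ht').2 h2⟩, mem_univ _, ?_⟩
      exact Subtype.ext (mul_div_cancel₀ _ ht'.ne')
  have hpar : IsParametrization (g ∘ m) (g '' Icc 0 t) := by
    refine ⟨(hg.continuous hL).comp ?_, ?_⟩
    · exact continuous_const.mul continuous_id
    · rw [range_comp, ← image_univ (f := m), hmi]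
  rw [curveLength_eq hpar (hgi.comp hmm.injective),
    eVariationOn.comp_eq_of_monotoneOn g m (hmm.monotone.monotoneOn _), hmi, hg 0 t ht.le]
  simp

/-! ### Rigidity of the constant-speed parametrization -/

/-- A continuous function on an interval with `φ a = 0` and `φ b = 1`, `a ≤ b`, has a monotone right
inverse: the first time at which each value is reached. -/
theorem exists_monotone_rightInverse {φ : I → I} (hφ : Continuous φ) {a b : I} (hab : a ≤ b)
    (ha : φ a = 0) (hb : φ b = 1) : ∃ ψ : I → I, Monotone ψ ∧ ∀ u, φ (ψ u) = u := by
  set S : I → Set I := fun u => {s | a ≤ s ∧ u ≤ φ s} with hS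
  have hne : ∀ u, (S u).Nonempty := fun u => ⟨b, hab, hb ▸ u.2.2⟩
  have hcl : ∀ u, IsClosed (S u) := fun u =>
    isClosed_Ici.inter (isClosed_Ici.preimage hφ)
  have hmem : ∀ u, sInf (S u) ∈ S u := fun u => (hcl u).csInf_mem (hne u) (OrderBot.bddBelow _)
  refine ⟨fun u => sInf (S u), fun u w huw => ?_, fun u => ?_⟩
  · exact csInf_le (OrderBot.bddBelow _) ⟨(hmem w).1, huw.trans (hmem w).2⟩
  · obtain ⟨s, hs, hsu⟩ := intermediate_value_Icc (hmem u).1 hφ.continuousOn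
      (show u ∈ Icc (φ a) (φ (sInf (S u))) from ⟨ha ▸ u.2.1, (hmem u).2⟩)
    have : sInf (S u) ≤ s := csInf_le (OrderBot.bddBelow _) ⟨hs.1, hsu.ge⟩
    change φ (sInf (S u)) = u
    rw [le_antisymm this hs.2, hsu]

theorem eVariationOn_comp_le_of_dist_le {h : I → Plane} {L : ℝ} (hL : 0 ≤ L)
    (hh : ∀ s t : I, dist (h s) (h t) ≤ L * |(s : ℝ) - t|) {ψ : I → I} (hψ : Monotone ψ)
    {u w : I} (huw : u ≤ w) :
    eVariationOn (h ∘ ψ) (Icc u w) ≤ ENNReal.ofReal (L * ((ψ w : ℝ) - ψ u)) := by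
  have hlip : LipschitzOnWith L.toNNReal h univ :=
    (LipschitzWith.of_dist_le_mul fun s t => by
      rw [Real.coe_toNNReal L hL, Subtype.dist_eq, Real.dist_eq]
      exact hh s t).lipschitzOnWith
  refine (hlip.comp_eVariationOn_le (mapsTo_univ ψ _)).trans ?_
  have h1 : eVariationOn ψ (Icc u w) = eVariationOn (fun s => (ψ s : ℝ)) (Icc u w) := rfl
  have h2 : MonotoneOn (fun s => (ψ s : ℝ)) (Icc u w) := fun a _ b _ hab => hψ hab
  have h3 := h2.eVariationOn_eq (left_mem_Icc.2 huw) (right_mem_Icc.2 huw)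
  rw [inter_self] at h3
  rw [h1, h3, ENNReal.ofReal_mul hL]
  rfl

theorem eq_of_dist_le_of_le {g h : I → Plane} {L : ℝ} (hL : 0 < L) (hg : HasConstantSpeed g L)
    (hh : ∀ s t : I, dist (h s) (h t) ≤ L * |(s : ℝ) - t|) {φ : I → I} (hφ : Continuous φ)
    (hgφ : ∀ t, g (φ t) = h t) {a b : I} (hab : a ≤ b) (ha : φ a = 0) (hb : φ b = 1) : h = g := by
  obtain ⟨ψ, hψm, hψ⟩ := exists_monotone_rightInverse hφ hab ha hb
  have hcomp : h ∘ ψ = g := funext fun u => by rw [Function.comp_apply, ← hgφ, hψ]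
  -- the first hitting times spread at least as much as the values, so they are the identity
  have hspread : ∀ u w : I, u ≤ w → (w : ℝ) - u ≤ ψ w - ψ u := by
    intro u w huw
    have h1 := eVariationOn_comp_le_of_dist_le hL.le hh hψm huw
    rw [hcomp, hg u w huw, ENNReal.ofReal_le_ofReal_iff] at h1
    · exact le_of_mul_le_mul_left h1 hL
    · exact mul_nonneg hL.le (sub_nonneg.2 (hψm huw))
  have hid : ∀ u, ψ u = u := by
    intro u
    have h1 := hspread 0 u u.2.1
    have h2 := hspread u 1 u.2.2
    have h3 := (ψ 0).2.1
    have h4 := (ψ 1).2.2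
    have h5 : ((0 : I) : ℝ) = 0 := rfl
    have h6 : ((1 : I) : ℝ) = 1 := rfl
    exact Subtype.ext (by linarith)
  rw [← hcomp]
  exact funext fun u => by rw [Function.comp_apply, hid]

/-- An `L`-Lipschitz path from `[0,1]` onto an arc of length `L` is the constant-speed
parametrization of the arc or its reverse. The coordinate `c` tells the two apart. -/
theorem eq_of_dist_le_of_range_eq {g h : I → Plane} {L : ℝ} (hL : 0 < L)
    (hg : HasConstantSpeed g L) (hgi : Function.Injective g)
    (hh : ∀ s t : I, dist (h s) (h t) ≤ L * |(s : ℝ) - t|) (hr : range h = range g)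
    {c : Fin 2} (hgc : g 0 c < g 1 c) (hhc : h 0 c ≤ h 1 c) : h = g := by
  have hhcont : Continuous h :=
    (LipschitzWith.of_dist_le_mul (K := L.toNNReal) fun s t => by
      rw [Real.coe_toNNReal L hL.le, Subtype.dist_eq, Real.dist_eq]
      exact hh s t).continuous
  obtain ⟨φ, hφ, hgφ⟩ := exists_lift_of_range_subset hhcont (hg.continuous hL.le) hgi hr.le
  have hφs : ∀ u, ∃ t, φ t = u := fun u => by
    obtain ⟨t, ht⟩ : g u ∈ range h := hr ▸ mem_range_self u
    exact ⟨t, hgi ((hgφ t).trans ht)⟩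
  obtain ⟨a, ha⟩ := hφs 0
  obtain ⟨b, hb⟩ := hφs 1
  rcases le_total a b with hab | hba
  · exact eq_of_dist_le_of_le hL hg hh hφ hgφ hab ha hb
  · exfalso
    have key : h ∘ σ = g := by
      refine eq_of_dist_le_of_le (φ := φ ∘ σ) (a := σ a) (b := σ b) hL hg (fun s t => ?_)
        (hφ.comp continuous_symm) (fun t => hgφ (σ t)) (symm_le_symm.2 hba) ?_ ?_
      · refine (hh _ _).trans_eq ?_
        rw [coe_symm_eq, coe_symm_eq, ← abs_neg]
        congr 2; ring
      · simpa using ha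
      · simpa using hb
    have h0 : h 1 = g 0 := by rw [← key]; simp
    have h1 : h 0 = g 1 := by rw [← key]; simp
    rw [h0, h1] at hhc
    exact absurd hgc (not_lt.2 hhc)

/-! ### Nearly optimal paths are close to the constant-speed parametrization -/

/-- `γ` is, up to the error `η`, an `L`-Lipschitz path onto the range of `g` which does not run
backwards with respect to the coordinate `c`. The path need not be continuous. -/
structure IsNearParametrization (g : I → Plane) (L : ℝ) (c : Fin 2) (η : ℝ) (γ : I → Plane) :
    Prop where
  dist_le : ∀ s t : I, dist (γ s) (γ t) ≤ (L + η) * |(s : ℝ) - t| + η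
  near_range : ∀ t, ∃ s, dist (γ t) (g s) ≤ η
  range_near : ∀ s, ∃ t, dist (γ t) (g s) ≤ η
  forward : γ 0 c ≤ γ 1 c + η

theorem exists_tendsto_ultrafilter {X : Type*} [TopologicalSpace X] [CompactSpace X]
    (U : Ultrafilter ℕ) (z : ℕ → X) : ∃ x, Tendsto z U (𝓝 x) := by
  obtain ⟨x, -, hx⟩ := isCompact_univ.ultrafilter_le_nhds (U.map z) (by simp)
  exact ⟨x, hx⟩

/-- By compactness, near parametrizations are uniformly close to the constant-speed parametrization.
A sequence of counterexamples would converge, along an ultrafilter, to an `L`-Lipschitz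
parametrization of the arc, which is `g` by rigidity. -/
theorem exists_forall_isNearParametrization {g : I → Plane} {L : ℝ} (hL : 0 < L)
    (hg : HasConstantSpeed g L) (hgi : Function.Injective g) {c : Fin 2} (hgc : g 0 c < g 1 c)
    {ε : ℝ} (hε : 0 < ε) :
    ∃ η > 0, ∀ γ, IsNearParametrization g L c η γ → ∀ t, dist (γ t) (g t) ≤ ε := by
  by_contra! hcon
  have hη : ∀ n : ℕ, (0 : ℝ) < 1 / ((n : ℝ) + 1) := fun n => by positivity
  choose γ hγ x hx using fun n : ℕ => hcon (1 / ((n : ℝ) + 1)) (hη n)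
  set U : Ultrafilter ℕ := hyperfilter ℕ
  have hgcont : Continuous g := hg.continuous hL.le
  have hη0 : Tendsto (fun n : ℕ => 1 / ((n : ℝ) + 1)) U (𝓝 0) :=
    tendsto_one_div_add_atTop_nhds_zero_nat.mono_left
      ((hyperfilter_le_cofinite).trans Nat.cofinite_eq_atTop.le)
  choose z hz using fun n t => (hγ n).near_range t
  choose ζ hζ using fun t => exists_tendsto_ultrafilter U (fun n => z n t)
  set h : I → Plane := fun t => g (ζ t) with hh
  have hlim : ∀ t, Tendsto (fun n => γ n t) U (𝓝 (h t)) := fun t => by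
    have h1 : Tendsto (fun n => g (z n t)) U (𝓝 (h t)) := (hgcont.tendsto _).comp (hζ t)
    refine (tendsto_iff_of_dist ?_).2 h1
    exact squeeze_zero (fun _ => dist_nonneg) (fun n => hz n t) hη0
  have hlim' : ∀ (t : ℕ → I) (t₀ : I), Tendsto t U (𝓝 t₀) →
      Tendsto (fun n => γ n (t n)) U (𝓝 (h t₀)) := fun t t₀ ht => by
    refine (tendsto_iff_of_dist ?_).2 (hlim t₀)
    refine squeeze_zero (fun _ => dist_nonneg) (fun n => (hγ n).dist_le _ _) ?_
    have h1 : Tendsto (fun n => |(t n : ℝ) - t₀|) U (𝓝 0) := by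
      have := (continuous_subtype_val.tendsto t₀).comp ht
      have := (this.sub_const (t₀ : ℝ)).abs
      simpa using this
    have := ((hη0.const_add L).mul h1).add hη0
    simpa using this
  have hlip : ∀ s t : I, dist (h s) (h t) ≤ L * |(s : ℝ) - t| := fun s t => by
    have h1 := (hlim s).dist (hlim t)
    have h2 := ((hη0.const_add L).mul_const |(s : ℝ) - t|).add hη0
    simp only [add_zero] at h2
    exact le_of_tendsto_of_tendsto' h1 h2 fun n => (hγ n).dist_le s t
  have hrange : range h = range g := by
    refine Subset.antisymm (range_subset_iff.2 fun t => mem_range_self _) ?_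
    rintro _ ⟨s, rfl⟩
    choose t ht using fun n => (hγ n).range_near s
    obtain ⟨t₀, ht₀⟩ := exists_tendsto_ultrafilter U t
    refine ⟨t₀, tendsto_nhds_unique (hlim' t t₀ ht₀) ?_⟩
    rw [tendsto_iff_dist_tendsto_zero]
    exact squeeze_zero (fun _ => dist_nonneg) ht hη0
  have hforward : h 0 c ≤ h 1 c := by
    have hc : Continuous fun p : Plane => p c := by fun_prop
    have h1 := (hc.tendsto _).comp (hlim 0)
    have h2 := ((hc.tendsto _).comp (hlim 1)).add hη0
    rw [add_zero] at h2
    exact le_of_tendsto_of_tendsto' h1 h2 fun n => (hγ n).forward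
  have key : h = g := eq_of_dist_le_of_range_eq hL hg hgi hlip hrange hgc hforward
  obtain ⟨x₀, hx₀⟩ := exists_tendsto_ultrafilter U x
  have h1 := (hlim' x x₀ hx₀).dist ((hgcont.tendsto x₀).comp hx₀)
  rw [key, dist_self] at h1
  exact absurd (ge_of_tendsto' h1 fun n => (hx n).le) (not_le.2 hε)

/-! ### Primitive recursive arithmetic on codes and lists -/

theorem encode_int_ofNat (n : ℕ) : Encodable.encode (n : ℤ) = 2 * n := rfl

theorem encode_int_negSucc (n : ℕ) : Encodable.encode (Int.negSucc n) = 2 * n + 1 := rfl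

theorem primrec_nat_pow : Primrec₂ (fun m n : ℕ => m ^ n) :=
  Primrec₂.unpaired'.1 Nat.Primrec.pow

theorem primrec_int_add_toNat : Primrec₂ fun (z : ℤ) (n : ℕ) => (z + n).toNat := by
  have h : Primrec₂ fun (z : ℤ) (n : ℕ) =>
      if Encodable.encode z % 2 = 0 then Encodable.encode z / 2 + n
      else n - (Encodable.encode z / 2 + 1) := by
    have he : Primrec fun p : ℤ × ℕ => Encodable.encode p.1 := Primrec.encode.comp Primrec.fst
    have hd := Primrec.nat_div.comp he (Primrec.const 2)
    refine Primrec.ite ?_ ?_ ?_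
    · exact Primrec.eq.comp (Primrec.nat_mod.comp he (Primrec.const 2)) (Primrec.const 0)
    · exact Primrec.nat_add.comp hd Primrec.snd
    · exact Primrec.nat_sub.comp Primrec.snd (Primrec.nat_add.comp hd (Primrec.const 1))
  refine h.of_eq fun z n => ?_
  rcases z with m | m
  · have := encode_int_ofNat m
    simp only [Int.ofNat_eq_natCast] at *
    rw [this, if_pos (by omega)]
    omega
  · rw [encode_int_negSucc, if_neg (by omega)]
    omega

theorem primrec_int_sub : Primrec₂ fun a b : ℕ => (a : ℤ) - b := by
  have h : Primrec₂ fun a b : ℕ => if b ≤ a then 2 * (a - b) else 2 * (b - a - 1) + 1 := by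
    have hf : Primrec fun p : ℕ × ℕ => p.1 := Primrec.fst
    have hs : Primrec fun p : ℕ × ℕ => p.2 := Primrec.snd
    refine Primrec.ite (Primrec.nat_le.comp hs hf) ?_ ?_
    · exact Primrec.nat_double.comp (Primrec.nat_sub.comp hf hs)
    · exact Primrec.nat_double_succ.comp
        (Primrec.nat_sub.comp (Primrec.nat_sub.comp hs hf) (Primrec.const 1))
  refine Primrec₂.encode_iff.1 (h.of_eq fun a b => ?_)
  split_ifs with hab
  · rw [← Nat.cast_sub hab, encode_int_ofNat]
  · rw [show (a : ℤ) - b = Int.negSucc (b - a - 1) by omega, encode_int_negSucc]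

theorem primrec_nat_dist : Primrec₂ Nat.dist :=
  Primrec.nat_add.comp₂ Primrec.nat_sub (Primrec.nat_sub.comp₂ Primrec₂.right Primrec₂.left)

theorem cast_nat_dist (a b : ℕ) : ((Nat.dist a b : ℕ) : ℝ) = |(a : ℝ) - b| := by
  rcases le_total a b with h | h
  · rw [Nat.dist_eq_sub_of_le h, Nat.cast_sub h, abs_sub_comm,
      abs_of_nonneg (sub_nonneg.2 (Nat.cast_le.2 h))]
  · rw [Nat.dist_eq_sub_of_le_right h, Nat.cast_sub h,
      abs_of_nonneg (sub_nonneg.2 (Nat.cast_le.2 h))]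

/-- The integer part of `(x + B) * 2 ^ m`, where `x` is the rational number with the code `c`. It is
`0` if `x + B` is negative. -/
def floorCode (B m : ℕ) (c : RatCode) : ℕ :=
  (c.1 + (B * (c.2 + 1) : ℕ)).toNat * 2 ^ m / (c.2 + 1)

theorem primrec_floorCode (B : ℕ) : Primrec₂ (floorCode B) := by
  have hm : Primrec fun p : ℕ × RatCode => p.1 := Primrec.fst
  have hp : Primrec fun p : ℕ × RatCode => p.2.1 := Primrec.fst.comp Primrec.snd
  have hq : Primrec fun p : ℕ × RatCode => p.2.2 + 1 :=
    Primrec.succ.comp (Primrec.snd.comp Primrec.snd)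
  exact Primrec.nat_div.comp (Primrec.nat_mul.comp
    (primrec_int_add_toNat.comp hp (Primrec.nat_mul.comp (Primrec.const B) hq))
    (primrec_nat_pow.comp (Primrec.const 2) hm)) hq

theorem floorCode_eq (B m : ℕ) (c : RatCode) :
    floorCode B m c = ⌊(RatCode.val c + B) * 2 ^ m⌋₊ := by
  have hq : (0 : ℝ) < (c.2 : ℝ) + 1 := by positivity
  have hval : RatCode.val c + B = ((c.1 + (B * (c.2 + 1) : ℕ) : ℤ) : ℝ) / ((c.2 : ℝ) + 1) := by
    rw [RatCode.val]
    push_cast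
    field_simp
  rw [hval, floorCode]
  rcases le_or_gt 0 (c.1 + (B * (c.2 + 1) : ℕ) : ℤ) with h | h
  · obtain ⟨k, hk⟩ := Int.eq_ofNat_of_zero_le h
    rw [hk, Int.toNat_natCast, Int.cast_natCast, div_mul_eq_mul_div,
      ← Nat.floor_div_eq_div (K := ℝ)]
    push_cast
    rfl
  · rw [Int.toNat_of_nonpos h.le, zero_mul, Nat.zero_div, eq_comm]
    refine Nat.floor_of_nonpos ?_
    refine mul_nonpos_of_nonpos_of_nonneg ?_ (by positivity)
    exact div_nonpos_of_nonpos_of_nonneg (by exact_mod_cast h.le) hq.le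

/-- All lists of length `n` with entries from `A`. -/
def listsOfLength {α : Type*} (A : List α) : ℕ → List (List α)
  | 0 => [[]]
  | n + 1 => A.flatMap fun a => (listsOfLength A n).map (a :: ·)

theorem mem_listsOfLength {α : Type*} {A : List α} {n : ℕ} {l : List α} :
    l ∈ listsOfLength A n ↔ l.length = n ∧ ∀ a ∈ l, a ∈ A := by
  induction n generalizing l with
  | zero => simp +contextual [listsOfLength]
  | succ n ih =>
    simp only [listsOfLength, List.mem_flatMap, List.mem_map, ih]
    constructor
    · rintro ⟨a, ha, t, ⟨h1, h2⟩, rfl⟩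
      simpa [h1, ha] using h2
    · rcases l with _ | ⟨a, t⟩
      · simp
      · rintro ⟨h1, h2⟩
        exact ⟨a, h2 a (by simp), t, ⟨by simpa using h1, fun b hb => h2 b (by simp [hb])⟩, rfl⟩

theorem primrec_listsOfLength {α : Type*} [Primcodable α] :
    Primrec₂ (listsOfLength : List α → ℕ → List (List α)) := by
  have h : Primrec₂ fun (A : List α) (n : ℕ) => Nat.rec (motive := fun _ => List (List α)) [[]]
      (fun _ ih => A.flatMap fun a => ih.map (a :: ·)) n := by
    refine Primrec.nat_rec (g := fun (A : List α) (p : ℕ × List (List α)) =>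
      A.flatMap fun a => p.2.map (a :: ·)) (Primrec.const [[]]) ?_
    refine Primrec.list_flatMap Primrec.fst ?_
    refine Primrec.list_map (Primrec.snd.comp (Primrec.snd.comp Primrec.fst)) ?_
    exact Primrec.list_cons.comp (Primrec.snd.comp Primrec.fst) Primrec.snd
  refine h.of_eq fun A n => ?_
  induction n with
  | zero => rfl
  | succ n ih => simp only [listsOfLength, ← ih]

/-! ### The search for candidate paths -/

/-- A coordinate of a point of the integer grid. -/
def gridCoord (c : Fin 2) (a : ℕ × ℕ) : ℕ := if c = 0 then a.1 else a.2

theorem primrec_gridCoord (c : Fin 2) : Primrec (gridCoord c) := by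
  unfold gridCoord
  split_ifs
  · exact Primrec.fst
  · exact Primrec.snd

/-- The grid points at scale `2 ^ m`, translated by `B`, which are close to a neighbourhood in the
list `Q`: each coordinate differs from that of the centre by at most the radius plus two units. -/
def gridCover (B m : ℕ) (Q : List NhdCode) : List (ℕ × ℕ) :=
  ((List.range (2 * B * 2 ^ m + 1)).flatMap fun i =>
    (List.range (2 * B * 2 ^ m + 1)).map fun j => (i, j)).filter fun a =>
      ∃ c ∈ Q, Nat.dist a.1 (floorCode B m c.1.1) ≤ floorCode 0 m c.2 + 2 ∧
        Nat.dist a.2 (floorCode B m c.1.2) ≤ floorCode 0 m c.2 + 2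

theorem primrec_gridCover (B : ℕ) : Primrec₂ (gridCover B) := by
  have hrange : Primrec fun m : ℕ => List.range (2 * B * 2 ^ m + 1) :=
    Primrec.list_range.comp (Primrec.succ.comp (Primrec.nat_mul.comp (Primrec.const (2 * B))
      (primrec_nat_pow.comp (Primrec.const 2) Primrec.id)))
  have hgrid : Primrec fun m : ℕ => (List.range (2 * B * 2 ^ m + 1)).flatMap fun i =>
      (List.range (2 * B * 2 ^ m + 1)).map fun j => (i, j) := by
    refine Primrec.list_flatMap hrange ?_
    refine Primrec.list_map (hrange.comp Primrec.fst) ?_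
    exact Primrec.pair (Primrec.snd.comp Primrec.fst) Primrec.snd
  have hnear : PrimrecRel fun (c : NhdCode) (p : (ℕ × ℕ) × ℕ) =>
      Nat.dist p.1.1 (floorCode B p.2 c.1.1) ≤ floorCode 0 p.2 c.2 + 2 ∧
        Nat.dist p.1.2 (floorCode B p.2 c.1.2) ≤ floorCode 0 p.2 c.2 + 2 := by
    have hc : Primrec fun q : NhdCode × ((ℕ × ℕ) × ℕ) => q.1 := Primrec.fst
    have hm : Primrec fun q : NhdCode × ((ℕ × ℕ) × ℕ) => q.2.2 := Primrec.snd.comp Primrec.snd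
    have ha : Primrec fun q : NhdCode × ((ℕ × ℕ) × ℕ) => q.2.1 := Primrec.fst.comp Primrec.snd
    have hr : Primrec fun q : NhdCode × ((ℕ × ℕ) × ℕ) => floorCode 0 q.2.2 q.1.2 + 2 :=
      Primrec.nat_add.comp ((primrec_floorCode 0).comp hm (Primrec.snd.comp hc)) (Primrec.const 2)
    refine PrimrecPred.and ?_ ?_
    · exact Primrec.nat_le.comp (primrec_nat_dist.comp (Primrec.fst.comp ha)
        ((primrec_floorCode B).comp hm (Primrec.fst.comp (Primrec.fst.comp hc)))) hr
    · exact Primrec.nat_le.comp (primrec_nat_dist.comp (Primrec.snd.comp ha)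
        ((primrec_floorCode B).comp hm (Primrec.snd.comp (Primrec.fst.comp hc)))) hr
  have hex := PrimrecRel.exists_mem_list hnear
  have hrel : PrimrecRel fun (a : ℕ × ℕ) (p : ℕ × List NhdCode) =>
      ∃ c ∈ p.2, Nat.dist a.1 (floorCode B p.1 c.1.1) ≤ floorCode 0 p.1 c.2 + 2 ∧
        Nat.dist a.2 (floorCode B p.1 c.1.2) ≤ floorCode 0 p.1 c.2 + 2 :=
    hex.comp (Primrec.snd.comp Primrec.snd)
      (Primrec.pair Primrec.fst (Primrec.fst.comp Primrec.snd))
  exact (PrimrecRel.listFilter hrel).comp (hgrid.comp Primrec.fst) Primrec.id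

/-- The list `l` of `N + 1` grid points describes a path which is possibly a sampling of the
constant-speed parametrization of the arc: its steps have at most the length `S + 2`, every point of
`A` is near one of its points, and its end does not precede its start in the coordinate `c`.
In units of the grid, `S` bounds the length of the arc between consecutive sampling times. Rounding
to the grid adds at most `2` to the length of a step, and the points of `A` have coordinates within
`5` of those of a point of the arc, hence within `S + 6` of those of a rounded sample. -/
def IsCandidate (c : Fin 2) (N S : ℕ) (A l : List (ℕ × ℕ)) : Prop :=
  (∀ i < N, Nat.dist (l.getD i 0).1 (l.getD (i + 1) 0).1 ^ 2 +
    Nat.dist (l.getD i 0).2 (l.getD (i + 1) 0).2 ^ 2 ≤ (S + 2) ^ 2) ∧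
  (∀ a ∈ A, ∃ i < N + 1, Nat.dist a.1 (l.getD i 0).1 ≤ S + 6 ∧
    Nat.dist a.2 (l.getD i 0).2 ≤ S + 6) ∧
  gridCoord c (l.getD 0 0) ≤ gridCoord c (l.getD N 0)

theorem primrecRel_isCandidate (c : Fin 2) :
    PrimrecRel fun (l : List (ℕ × ℕ)) (p : (ℕ × ℕ) × List (ℕ × ℕ)) =>
      IsCandidate c p.1.1 p.1.2 p.2 l := by
  have hget : Primrec₂ fun (l : List (ℕ × ℕ)) (i : ℕ) => l.getD i 0 := Primrec.list_getD 0
  refine PrimrecPred.and ?_ (PrimrecPred.and ?_ ?_)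
  · have h : PrimrecRel fun (i : ℕ) (q : ℕ × List (ℕ × ℕ)) =>
        Nat.dist (q.2.getD i 0).1 (q.2.getD (i + 1) 0).1 ^ 2 +
          Nat.dist (q.2.getD i 0).2 (q.2.getD (i + 1) 0).2 ^ 2 ≤ (q.1 + 2) ^ 2 := by
      have hl : Primrec fun r : ℕ × (ℕ × List (ℕ × ℕ)) => r.2.2 := Primrec.snd.comp Primrec.snd
      have h1 := hget.comp hl Primrec.fst
      have h2 := hget.comp hl (Primrec.succ.comp Primrec.fst)
      have hsq {f : ℕ × (ℕ × List (ℕ × ℕ)) → ℕ} (hf : Primrec f) : Primrec fun r => f r ^ 2 :=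
        primrec_nat_pow.comp hf (Primrec.const 2)
      exact Primrec.nat_le.comp (Primrec.nat_add.comp
        (hsq (primrec_nat_dist.comp (Primrec.fst.comp h1) (Primrec.fst.comp h2)))
        (hsq (primrec_nat_dist.comp (Primrec.snd.comp h1) (Primrec.snd.comp h2))))
        (hsq (Primrec.nat_add.comp (Primrec.fst.comp Primrec.snd) (Primrec.const 2)))
    have h' := (PrimrecRel.forall_mem_list h).comp
      (Primrec.list_range.comp (Primrec.fst.comp (Primrec.fst.comp Primrec.snd)))
      (Primrec.pair (Primrec.snd.comp (Primrec.fst.comp Primrec.snd))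
        (Primrec.fst (α := List (ℕ × ℕ)) (β := (ℕ × ℕ) × List (ℕ × ℕ))))
    exact h'.of_eq fun p => by simp only [List.mem_range]
  · have h : PrimrecRel fun (i : ℕ) (q : (ℕ × ℕ) × (ℕ × List (ℕ × ℕ))) =>
        Nat.dist q.1.1 (q.2.2.getD i 0).1 ≤ q.2.1 + 6 ∧
          Nat.dist q.1.2 (q.2.2.getD i 0).2 ≤ q.2.1 + 6 := by
      have ha : Primrec fun r : ℕ × ((ℕ × ℕ) × (ℕ × List (ℕ × ℕ))) => r.2.1 :=
        Primrec.fst.comp Primrec.snd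
      have hS : Primrec fun r : ℕ × ((ℕ × ℕ) × (ℕ × List (ℕ × ℕ))) => r.2.2.1 + 6 :=
        Primrec.nat_add.comp (Primrec.fst.comp (Primrec.snd.comp Primrec.snd)) (Primrec.const 6)
      have hl : Primrec fun r : ℕ × ((ℕ × ℕ) × (ℕ × List (ℕ × ℕ))) => r.2.2.2 :=
        Primrec.snd.comp (Primrec.snd.comp Primrec.snd)
      have h1 := hget.comp hl Primrec.fst
      exact PrimrecPred.and
        (Primrec.nat_le.comp (primrec_nat_dist.comp (Primrec.fst.comp ha) (Primrec.fst.comp h1)) hS)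
        (Primrec.nat_le.comp (primrec_nat_dist.comp (Primrec.snd.comp ha) (Primrec.snd.comp h1)) hS)
    have h' : PrimrecRel fun (a : ℕ × ℕ) (q : ℕ × (ℕ × List (ℕ × ℕ))) => ∃ i < q.1 + 1,
        Nat.dist a.1 (q.2.2.getD i 0).1 ≤ q.2.1 + 6 ∧
          Nat.dist a.2 (q.2.2.getD i 0).2 ≤ q.2.1 + 6 := by
      have h'' := (PrimrecRel.exists_mem_list h).comp
        (Primrec.list_range.comp (Primrec.succ.comp (Primrec.fst.comp Primrec.snd)))
        (Primrec.pair (Primrec.fst (α := ℕ × ℕ) (β := ℕ × (ℕ × List (ℕ × ℕ))))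
          (Primrec.snd.comp Primrec.snd))
      exact h''.of_eq fun p => by simp only [List.mem_range, Nat.succ_eq_add_one]
    exact (PrimrecRel.forall_mem_list h').comp (Primrec.snd.comp Primrec.snd)
      (Primrec.pair (Primrec.fst.comp (Primrec.fst.comp Primrec.snd))
        (Primrec.pair (Primrec.snd.comp (Primrec.fst.comp Primrec.snd)) Primrec.fst))
  · exact Primrec.nat_le.comp
      ((primrec_gridCoord c).comp (hget.comp Primrec.fst (Primrec.const 0)))
      ((primrec_gridCoord c).comp
        (hget.comp Primrec.fst (Primrec.fst.comp (Primrec.fst.comp Primrec.snd))))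

open Classical in
/-- All candidate paths with `N` steps through points of `A`. -/
noncomputable def candidates (c : Fin 2) (N S : ℕ) (A : List (ℕ × ℕ)) : List (List (ℕ × ℕ)) :=
  (listsOfLength A (N + 1)).filter fun l => IsCandidate c N S A l

theorem mem_candidates {c : Fin 2} {N S : ℕ} {A l : List (ℕ × ℕ)} :
    l ∈ candidates c N S A ↔ (l.length = N + 1 ∧ ∀ a ∈ l, a ∈ A) ∧ IsCandidate c N S A l := by
  simp [candidates, mem_listsOfLength]

theorem primrec_candidates (c : Fin 2) :
    Primrec fun p : (ℕ × ℕ) × List (ℕ × ℕ) => candidates c p.1.1 p.1.2 p.2 := by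
  classical
  have h := (PrimrecRel.listFilter (primrecRel_isCandidate c)).comp
    (primrec_listsOfLength.comp Primrec.snd (Primrec.succ.comp (Primrec.fst.comp Primrec.fst)))
    (Primrec.id (α := (ℕ × ℕ) × List (ℕ × ℕ)))
  refine h.of_eq fun p => ?_
  simp only [candidates, id, Nat.succ_eq_add_one]

/-- Two paths agree at the time `i / 2 ^ k`, in the coordinate `d`, so well that either of them
gives this coordinate of the arc with precision `2⁻ⁿ`. The term `3 * S + 1` accounts for the
errors from sampling and from reading the argument. -/
def Agree (d : Fin 2) (k S i n : ℕ) (p q : List (ℕ × ℕ)) : Prop :=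
  (Nat.dist (gridCoord d (p.getD i 0)) (gridCoord d (q.getD i 0)) + (3 * S + 1)) * 2 ^ n ≤ 4 ^ k

theorem primrecRel_agree (d : Fin 2) :
    PrimrecRel fun (q : List (ℕ × ℕ)) (r : (ℕ × ℕ × ℕ × ℕ) × List (ℕ × ℕ)) =>
      Agree d r.1.1 r.1.2.1 r.1.2.2.1 r.1.2.2.2 r.2 q := by
  have hget : Primrec₂ fun (l : List (ℕ × ℕ)) (i : ℕ) => gridCoord d (l.getD i 0) :=
    (primrec_gridCoord d).comp₂ (Primrec.list_getD 0)
  have hv : Primrec fun s : List (ℕ × ℕ) × ((ℕ × ℕ × ℕ × ℕ) × List (ℕ × ℕ)) => s.2.1 :=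
    Primrec.fst.comp Primrec.snd
  have hi : Primrec fun s : List (ℕ × ℕ) × ((ℕ × ℕ × ℕ × ℕ) × List (ℕ × ℕ)) => s.2.1.2.2.1 :=
    Primrec.fst.comp (Primrec.snd.comp (Primrec.snd.comp hv))
  have h1 := primrec_nat_dist.comp (hget.comp (Primrec.snd.comp Primrec.snd) hi)
      (hget.comp Primrec.fst hi)
  have h2 : Primrec fun s : List (ℕ × ℕ) × ((ℕ × ℕ × ℕ × ℕ) × List (ℕ × ℕ)) =>
      3 * s.2.1.2.1 + 1 :=
    Primrec.succ.comp (Primrec.nat_mul.comp (Primrec.const 3)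
      (Primrec.fst.comp (Primrec.snd.comp hv)))
  have h3 : Primrec fun s : List (ℕ × ℕ) × ((ℕ × ℕ × ℕ × ℕ) × List (ℕ × ℕ)) =>
      2 ^ s.2.1.2.2.2 :=
    primrec_nat_pow.comp (Primrec.const 2)
      (Primrec.snd.comp (Primrec.snd.comp (Primrec.snd.comp hv)))
  exact Primrec.nat_le.comp (Primrec.nat_mul.comp (Primrec.nat_add.comp h1 h2) h3)
    (primrec_nat_pow.comp (Primrec.const 4) (Primrec.fst.comp hv))

/-- The code of the rational number `a / 4 ^ k - B`. -/
def gridCode (B k a : ℕ) : RatCode := ((a : ℤ) - (B * 4 ^ k : ℕ), 4 ^ k - 1)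

theorem primrec_gridCode (B : ℕ) : Primrec₂ (gridCode B) := by
  have hpow : Primrec fun p : ℕ × ℕ => 4 ^ p.1 :=
    primrec_nat_pow.comp (Primrec.const 4) Primrec.fst
  exact Primrec.pair
    (primrec_int_sub.comp Primrec.snd (Primrec.nat_mul.comp (Primrec.const B) hpow))
    (Primrec.nat_sub.comp hpow (Primrec.const 1))

theorem val_gridCode (B k a : ℕ) : RatCode.val (gridCode B k a) = a / 4 ^ k - B := by
  have h : ((4 ^ k - 1 : ℕ) : ℝ) + 1 = 4 ^ k := by
    rw [Nat.cast_sub (Nat.one_le_pow _ _ (by norm_num))]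
    push_cast
    ring
  rw [RatCode.val, gridCode, h]
  push_cast
  field_simp

open Classical in
/-- The answer which a list `P` of candidate paths gives to the question for the coordinate `d` at
the time `i / 2 ^ k` with precision `2⁻ⁿ`: the value of one path, provided that all paths agree
with it. -/
noncomputable def answer (d : Fin 2) (B k S i n : ℕ) (P : List (List (ℕ × ℕ))) : Option RatCode :=
  P.head?.bind fun p =>
    if ∀ q ∈ P, Agree d k S i n p q then some (gridCode B k (gridCoord d (p.getD i 0))) else none

theorem primrec_answer (d : Fin 2) (B : ℕ) :
    Primrec fun p : (ℕ × ℕ × ℕ × ℕ) × List (List (ℕ × ℕ)) =>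
      answer d B p.1.1 p.1.2.1 p.1.2.2.1 p.1.2.2.2 p.2 := by
  have hget : Primrec₂ fun (l : List (ℕ × ℕ)) (i : ℕ) => gridCoord d (l.getD i 0) :=
    (primrec_gridCoord d).comp₂ (Primrec.list_getD 0)
  have hu : Primrec fun s : ((ℕ × ℕ × ℕ × ℕ) × List (List (ℕ × ℕ))) × List (ℕ × ℕ) => s.1.1 :=
    Primrec.fst.comp Primrec.fst
  have hi : Primrec fun s : ((ℕ × ℕ × ℕ × ℕ) × List (List (ℕ × ℕ))) × List (ℕ × ℕ) =>
      s.1.1.2.2.1 := Primrec.fst.comp (Primrec.snd.comp (Primrec.snd.comp hu))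
  have hall := (PrimrecRel.forall_mem_list (primrecRel_agree d)).comp
    (Primrec.snd.comp (Primrec.fst (α := (ℕ × ℕ × ℕ × ℕ) × List (List (ℕ × ℕ)))
      (β := List (ℕ × ℕ)))) (Primrec.pair hu Primrec.snd)
  have hval := (primrec_gridCode B).comp (Primrec.fst.comp hu) (hget.comp Primrec.snd hi)
  classical
  exact Primrec.option_bind (Primrec.list_head?.comp Primrec.snd)
    (Primrec.ite hall (Primrec.option_some.comp hval) (Primrec.const none)).to₂

/-- The answer at stage `k`, when `x` and `l` are codes of approximations of the argument and of the
length of the arc, and `A` consists of grid points near the arc at the scale `4 ^ k`. -/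
noncomputable def stageAnswer (c d : Fin 2) (B k n : ℕ) (x l : RatCode) (A : List (ℕ × ℕ)) :
    Option RatCode :=
  answer d B k (floorCode 0 k l + 2) (min (floorCode 0 k x) (2 ^ k)) n
    (candidates c (2 ^ k) (floorCode 0 k l + 2) A)

theorem primrec_stageAnswer (c d : Fin 2) (B : ℕ) :
    Primrec fun u : (ℕ × ℕ) × RatCode × RatCode × List (ℕ × ℕ) =>
      stageAnswer c d B u.1.1 u.1.2 u.2.1 u.2.2.1 u.2.2.2 := by
  have hk : Primrec fun u : (ℕ × ℕ) × RatCode × RatCode × List (ℕ × ℕ) => u.1.1 :=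
    Primrec.fst.comp Primrec.fst
  have hS : Primrec fun u : (ℕ × ℕ) × RatCode × RatCode × List (ℕ × ℕ) =>
      floorCode 0 u.1.1 u.2.2.1 + 2 :=
    Primrec.nat_add.comp ((primrec_floorCode 0).comp hk
      (Primrec.fst.comp (Primrec.snd.comp Primrec.snd))) (Primrec.const 2)
  have hN : Primrec fun u : (ℕ × ℕ) × RatCode × RatCode × List (ℕ × ℕ) => 2 ^ u.1.1 :=
    primrec_nat_pow.comp (Primrec.const 2) hk
  have hi := Primrec.nat_min.comp
    ((primrec_floorCode 0).comp hk (Primrec.fst.comp Primrec.snd)) hN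
  have hP := (primrec_candidates c).comp (Primrec.pair (Primrec.pair hN hS)
    (Primrec.snd.comp (Primrec.snd.comp Primrec.snd)))
  exact (primrec_answer d B).comp (Primrec.pair (Primrec.pair hk (Primrec.pair hS
    (Primrec.pair hi (Primrec.snd.comp Primrec.fst)))) hP)

/-- The machine which computes the coordinate `d` of the constant-speed parametrization. After `k`
steps it uses the last term read of the name of the argument, the grid points `G (2 * k)` near the
arc, and the approximation `ℓ k` of its length. -/
noncomputable def arcMachine (c d : Fin 2) (B : ℕ) (G : ℕ → List (ℕ × ℕ)) (ℓ : ℕ → RatCode)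
    (w : List RatCode) (n : ℕ) : Option RatCode :=
  w.reverse.head?.bind fun x =>
    stageAnswer c d B w.length n x (ℓ w.length) (G (2 * w.length))

theorem computable_arcMachine (c d : Fin 2) (B : ℕ) {G : ℕ → List (ℕ × ℕ)} {ℓ : ℕ → RatCode}
    (hG : Computable G) (hℓ : Computable ℓ) : Computable₂ (arcMachine c d B G ℓ) := by
  have hlen : Computable fun r : (List RatCode × ℕ) × RatCode => r.1.1.length :=
    Computable.list_length.comp (Computable.fst.comp Computable.fst)
  have hdata := (hlen.pair (Computable.snd.comp Computable.fst)).pair (Computable.snd.pair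
    ((hℓ.comp hlen).pair (hG.comp (Primrec.nat_double.to_comp.comp hlen))))
  have hstage := (primrec_stageAnswer c d B).to_comp.comp hdata
  have hhead : Computable fun p : List RatCode × ℕ => p.1.reverse.head? :=
    (Primrec.list_head?.comp Primrec.list_reverse).to_comp.comp Computable.fst
  exact Computable.option_bind hhead hstage.to₂

/-! ### Candidate paths and the constant-speed parametrization -/

theorem abs_coord_sub_le_dist (z w : Plane) (d : Fin 2) : |z d - w d| ≤ dist z w := by
  rw [← Real.dist_eq, EuclideanSpace.dist_eq]
  refine Real.le_sqrt_of_sq_le ?_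
  exact Finset.single_le_sum (f := fun i => dist (z i) (w i) ^ 2) (fun _ _ => sq_nonneg _)
    (Finset.mem_univ d)

theorem dist_le_of_sq_add_sq_le {z w : Plane} {r : ℝ} (hr : 0 ≤ r)
    (h : (z 0 - w 0) ^ 2 + (z 1 - w 1) ^ 2 ≤ r ^ 2) : dist z w ≤ r := by
  rw [EuclideanSpace.dist_eq, Fin.sum_univ_two, Real.dist_eq, Real.dist_eq, sq_abs, sq_abs]
  exact Real.sqrt_le_iff.2 ⟨hr, h⟩

theorem sq_add_sq_le_of_dist_le {z w : Plane} {r : ℝ} (h : dist z w ≤ r) :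
    (z 0 - w 0) ^ 2 + (z 1 - w 1) ^ 2 ≤ r ^ 2 := by
  rw [EuclideanSpace.dist_eq, Fin.sum_univ_two, Real.dist_eq, Real.dist_eq, sq_abs, sq_abs] at h
  exact (Real.sqrt_le_iff.1 h).2

theorem dist_le_of_abs_coord_sub_le {z w : Plane} {r : ℝ} (hr : 0 ≤ r)
    (h : ∀ d, |z d - w d| ≤ r) : dist z w ≤ 2 * r := by
  refine dist_le_of_sq_add_sq_le (by positivity) ?_
  have h0 := sq_le_sq' (abs_le.1 (h 0)).1 (abs_le.1 (h 0)).2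
  have h1 := sq_le_sq' (abs_le.1 (h 1)).1 (abs_le.1 (h 1)).2
  nlinarith [sq_nonneg r]

theorem abs_floor_sub_le {x : ℝ} (hx : 0 ≤ x) : |(⌊x⌋₊ : ℝ) - x| ≤ 1 := by
  rw [abs_le]
  constructor <;> linarith [Nat.floor_le hx, Nat.lt_floor_add_one x]

theorem abs_floor_sub_floor_le {x y : ℝ} (hx : 0 ≤ x) (hy : 0 ≤ y) :
    |(⌊x⌋₊ : ℝ) - ⌊y⌋₊| ≤ |x - y| + 1 := by
  rw [abs_le]
  constructor <;> linarith [Nat.floor_le hx, Nat.lt_floor_add_one x, Nat.floor_le hy,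
    Nat.lt_floor_add_one y, le_abs_self (x - y), neg_abs_le (x - y)]

/-- The point of the integer grid below `z`, at scale `2 ^ m` and translated by `B`. -/
noncomputable def gridPoint (B m : ℕ) (z : Plane) : ℕ × ℕ :=
  (⌊(z 0 + B) * 2 ^ m⌋₊, ⌊(z 1 + B) * 2 ^ m⌋₊)

theorem gridCoord_gridPoint (B m : ℕ) (z : Plane) (d : Fin 2) :
    gridCoord d (gridPoint B m z) = ⌊(z d + B) * 2 ^ m⌋₊ := by
  fin_cases d <;> simp [gridCoord, gridPoint]

/-- What the search needs to know about the arc: the lists `G m` consist of grid points at scale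
`2 ^ m` near the arc and contain the grid points below all points of the arc, and `ℓ` is a name of
its length. The translation by `B` makes all coordinates nonnegative. -/
structure IsArcData (g : I → Plane) (L : ℝ) (B : ℕ) (G : ℕ → List (ℕ × ℕ)) (ℓ : ℕ → RatCode) :
    Prop where
  nonneg : ∀ t d, 0 ≤ g t d + B
  near : ∀ m, ∀ a ∈ G m, ∃ t, ∀ d, |(g t d + B) * 2 ^ m - gridCoord d a| ≤ 5
  mem : ∀ m t, gridPoint B m (g t) ∈ G m
  isName : IsName ℓ L

/-- The integer upper bound of `L * 2 ^ k`, exceeding it by at most `3`, read off from a name of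
`L`. -/
def lengthBound (ℓ : ℕ → RatCode) (k : ℕ) : ℕ := floorCode 0 k (ℓ k) + 2

theorem le_lengthBound {ℓ : ℕ → RatCode} {L : ℝ} (hℓ : IsName ℓ L) (k : ℕ) :
    L * 2 ^ k ≤ lengthBound ℓ k := by
  have h2 : (0 : ℝ) < 2 ^ k := by positivity
  have h := mul_le_mul_of_nonneg_right (abs_le.1 (hℓ k)).1 h2.le
  rw [neg_mul, one_div, inv_mul_cancel₀ h2.ne'] at h
  have h' := Nat.lt_floor_add_one ((RatCode.val (ℓ k) + (0 : ℕ)) * 2 ^ k)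
  rw [lengthBound, floorCode_eq]
  push_cast at *
  linarith

theorem lengthBound_le {ℓ : ℕ → RatCode} {L : ℝ} (hL : 0 ≤ L) (hℓ : IsName ℓ L) (k : ℕ) :
    (lengthBound ℓ k : ℝ) ≤ L * 2 ^ k + 3 := by
  have h2 : (0 : ℝ) < 2 ^ k := by positivity
  have h := mul_le_mul_of_nonneg_right (abs_le.1 (hℓ k)).2 h2.le
  rw [one_div, inv_mul_cancel₀ h2.ne'] at h
  rw [lengthBound, floorCode_eq]
  rcases le_total 0 ((RatCode.val (ℓ k) + (0 : ℕ)) * 2 ^ k) with h0 | h0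
  · have h' := Nat.floor_le h0
    push_cast at *
    linarith
  · rw [Nat.floor_of_nonpos h0]
    have := mul_nonneg hL h2.le
    push_cast
    linarith

/-- The time `i / 2 ^ k`, as a point of the unit interval. -/
noncomputable def sampleTime (k i : ℕ) : I := projIcc 0 1 zero_le_one ((i : ℝ) / 2 ^ k)

theorem coe_sampleTime {k i : ℕ} (h : i ≤ 2 ^ k) : (sampleTime k i : ℝ) = (i : ℝ) / 2 ^ k := by
  have h2 : (0 : ℝ) < 2 ^ k := by positivity
  have h' : (i : ℝ) ≤ 2 ^ k := by exact_mod_cast h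
  rw [sampleTime, projIcc_of_mem zero_le_one ⟨by positivity, (div_le_one h2).2 h'⟩]

/-- The constant-speed parametrization, sampled at the times `i / 2 ^ k` and rounded. -/
noncomputable def sampling (g : I → Plane) (B k : ℕ) : List (ℕ × ℕ) :=
  (List.range (2 ^ k + 1)).map fun i => gridPoint B (2 * k) (g (sampleTime k i))

theorem sampling_getD (g : I → Plane) (B : ℕ) {k i : ℕ} (h : i ≤ 2 ^ k) :
    (sampling g B k).getD i 0 = gridPoint B (2 * k) (g (sampleTime k i)) := by
  rw [sampling, List.getD_eq_getElem _ _ (by simpa using Nat.lt_succ_of_le h)]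
  simp

theorem two_pow_two_mul (k : ℕ) : (2 : ℝ) ^ (2 * k) = 2 ^ k * 2 ^ k := by
  rw [two_mul, pow_add]

theorem four_pow_eq (k : ℕ) : (4 : ℝ) ^ k = 2 ^ k * 2 ^ k := by
  rw [← mul_pow]; norm_num

theorem sampling_mem_candidates {g : I → Plane} {L : ℝ} (hL : 0 ≤ L) (hg : HasConstantSpeed g L)
    {c : Fin 2} (hgc : g 0 c ≤ g 1 c) {B : ℕ} {G : ℕ → List (ℕ × ℕ)} {ℓ : ℕ → RatCode}
    (hD : IsArcData g L B G ℓ) (k : ℕ) :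
    sampling g B k ∈ candidates c (2 ^ k) (lengthBound ℓ k) (G (2 * k)) := by
  have h2 : (0 : ℝ) < 2 ^ k := by positivity
  have hS := le_lengthBound hD.isName k
  have hLk : 0 ≤ L * 2 ^ k := by positivity
  have hnn : ∀ t d, 0 ≤ (g t d + B) * 2 ^ (2 * k) := fun t d =>
    mul_nonneg (hD.nonneg t d) (by positivity)
  -- distances between points of the arc in units of the grid
  have hdist : ∀ s t : I, |(s : ℝ) - t| ≤ 1 / 2 ^ k →
      dist (g s) (g t) * 2 ^ (2 * k) ≤ L * 2 ^ k := by
    intro s t hst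
    have h := hg.dist_le hL s t
    calc dist (g s) (g t) * 2 ^ (2 * k) ≤ (L * (1 / 2 ^ k)) * 2 ^ (2 * k) := by
          gcongr
          exact h.trans (by gcongr)
      _ = L * 2 ^ k := by rw [two_pow_two_mul]; field_simp
  refine mem_candidates.2 ⟨⟨by simp [sampling], ?_⟩, ?_, ?_, ?_⟩
  · intro a ha
    obtain ⟨i, -, rfl⟩ := List.mem_map.1 ha
    exact hD.mem _ _
  · intro i hi
    rw [sampling_getD g B hi.le, sampling_getD g B (Nat.succ_le_of_lt hi)]
    set s := sampleTime k i with hs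
    set t := sampleTime k (i + 1) with ht
    have hst : |(s : ℝ) - t| ≤ 1 / 2 ^ k := by
      rw [hs, ht, coe_sampleTime hi.le, coe_sampleTime (Nat.succ_le_of_lt hi), ← sub_div]
      push_cast
      rw [abs_div, abs_of_pos h2]
      gcongr
      rw [sub_add_cancel_left, abs_neg, abs_one]
    have hd := hdist s t hst
    have hsq := sq_add_sq_le_of_dist_le (le_refl (dist (g s) (g t)))
    have hsq' : ((g s 0 + B) * 2 ^ (2 * k) - (g t 0 + B) * 2 ^ (2 * k)) ^ 2 +
        ((g s 1 + B) * 2 ^ (2 * k) - (g t 1 + B) * 2 ^ (2 * k)) ^ 2 ≤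
          (lengthBound ℓ k : ℝ) ^ 2 := by
      calc _ = ((g s 0 - g t 0) ^ 2 + (g s 1 - g t 1) ^ 2) * (2 ^ (2 * k)) ^ 2 := by ring
        _ ≤ dist (g s) (g t) ^ 2 * (2 ^ (2 * k)) ^ 2 := by gcongr
        _ = (dist (g s) (g t) * 2 ^ (2 * k)) ^ 2 := by ring
        _ ≤ _ := by gcongr; exact hd.trans hS
    have h0 := abs_floor_sub_floor_le (hnn s 0) (hnn t 0)
    have h1 := abs_floor_sub_floor_le (hnn s 1) (hnn t 1)
    rw [← Nat.cast_le (α := ℝ)]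
    push_cast
    rw [cast_nat_dist, cast_nat_dist]
    simp only [gridPoint]
    set X := (g s 0 + B) * 2 ^ (2 * k) - (g t 0 + B) * 2 ^ (2 * k)
    set Y := (g s 1 + B) * 2 ^ (2 * k) - (g t 1 + B) * 2 ^ (2 * k)
    set S : ℝ := (lengthBound ℓ k : ℝ)
    have hS0 : 0 ≤ S := hLk.trans hS
    have hX : |X| ≤ S := abs_le_of_sq_le_sq (by nlinarith [sq_nonneg Y]) hS0
    have hY : |Y| ≤ S := abs_le_of_sq_le_sq (by nlinarith [sq_nonneg X]) hS0
    have hX2 := pow_le_pow_left₀ (abs_nonneg _) h0 2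
    have hY2 := pow_le_pow_left₀ (abs_nonneg _) h1 2
    have := sq_abs X
    have := sq_abs Y
    nlinarith
  · intro a ha
    obtain ⟨s, hs⟩ := hD.near _ a ha
    have hfl : ⌊(s : ℝ) * 2 ^ k⌋₊ ≤ 2 ^ k := by
      refine Nat.floor_le_of_le ?_
      push_cast
      exact mul_le_of_le_one_left h2.le s.2.2
    refine ⟨⌊(s : ℝ) * 2 ^ k⌋₊, Nat.lt_succ_of_le hfl, ?_⟩
    rw [sampling_getD g B hfl]
    set t := sampleTime k ⌊(s : ℝ) * 2 ^ k⌋₊ with ht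
    have hst : |(s : ℝ) - t| ≤ 1 / 2 ^ k := by
      rw [ht, coe_sampleTime hfl, le_div_iff₀ h2, ← abs_of_pos h2, ← abs_mul, sub_mul,
        abs_of_pos h2, div_mul_cancel₀ _ h2.ne', abs_sub_comm]
      exact abs_floor_sub_le (mul_nonneg s.2.1 h2.le)
    have hd := hdist s t hst
    have key : ∀ d, Nat.dist (gridCoord d a) (gridCoord d (gridPoint B (2 * k) (g t))) ≤
        lengthBound ℓ k + 6 := by
      intro d
      rw [← Nat.cast_le (α := ℝ), cast_nat_dist, gridCoord_gridPoint]
      push_cast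
      have h1 := hs d
      have h2 := abs_floor_sub_le (hnn t d)
      have h3 : |(g s d + B) * 2 ^ (2 * k) - (g t d + B) * 2 ^ (2 * k)| ≤ lengthBound ℓ k := by
        rw [← sub_mul, abs_mul, abs_of_pos (by positivity : (0 : ℝ) < 2 ^ (2 * k)),
          add_sub_add_right_eq_sub]
        refine le_trans ?_ (hd.trans hS)
        gcongr
        exact abs_coord_sub_le_dist _ _ d
      rw [abs_le] at h1 h2 h3 ⊢
      constructor <;> linarith [h1.1, h1.2, h2.1, h2.2, h3.1, h3.2]
    exact ⟨key 0, key 1⟩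
  · rw [sampling_getD g B (Nat.zero_le _), sampling_getD g B le_rfl, gridCoord_gridPoint,
      gridCoord_gridPoint]
    have h0 : sampleTime k 0 = 0 := Subtype.ext (by rw [coe_sampleTime (Nat.zero_le _)]; simp)
    have h1 : sampleTime k (2 ^ k) = 1 := Subtype.ext (by rw [coe_sampleTime le_rfl]; simp)
    rw [h0, h1]
    gcongr

/-- The step function on `[0,1]` whose values are the points of the list `l`. -/
noncomputable def pathOfList (B k : ℕ) (l : List (ℕ × ℕ)) (t : I) : Plane :=
  WithLp.toLp 2 fun d => (gridCoord d (l.getD ⌊(t : ℝ) * 2 ^ k⌋₊ 0) : ℝ) / 4 ^ k - B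

theorem pathOfList_apply (B k : ℕ) (l : List (ℕ × ℕ)) (t : I) (d : Fin 2) :
    pathOfList B k l t d = (gridCoord d (l.getD ⌊(t : ℝ) * 2 ^ k⌋₊ 0) : ℝ) / 4 ^ k - B := rfl

theorem floor_sampleTime {k i : ℕ} (h : i ≤ 2 ^ k) :
    ⌊(sampleTime k i : ℝ) * 2 ^ k⌋₊ = i := by
  rw [coe_sampleTime h, div_mul_cancel₀ _ (by positivity), Nat.floor_natCast]

theorem floor_mul_two_pow_le (k : ℕ) (t : I) : ⌊(t : ℝ) * 2 ^ k⌋₊ ≤ 2 ^ k := by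
  refine Nat.floor_le_of_le ?_
  push_cast
  exact mul_le_of_le_one_left (by positivity) t.2.2

/-- The grid and the approximation of the length are so fine, compared to the number `2 ^ k` of
steps, that candidate paths are near parametrizations with an error of order `2⁻ᵏ`. -/
theorem isNearParametrization_of_mem_candidates {g : I → Plane} {L : ℝ} (hL : 0 ≤ L)
    {c : Fin 2} {B : ℕ} {G : ℕ → List (ℕ × ℕ)} {ℓ : ℕ → RatCode}
    (hD : IsArcData g L B G ℓ) {k : ℕ} {l : List (ℕ × ℕ)}
    (hl : l ∈ candidates c (2 ^ k) (lengthBound ℓ k) (G (2 * k))) :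
    IsNearParametrization g L c ((2 * L + 30) / 2 ^ k) (pathOfList B k l) := by
  obtain ⟨⟨hlen, hmem⟩, hstep, hcover, hforw⟩ := mem_candidates.1 hl
  have h2 : (0 : ℝ) < 2 ^ k := by positivity
  have h21 : (1 : ℝ) ≤ 2 ^ k := one_le_pow₀ (by norm_num)
  have h4 : (0 : ℝ) < 4 ^ k := by positivity
  have h42 : (4 : ℝ) ^ k = 2 ^ k * 2 ^ k := four_pow_eq k
  have hS := lengthBound_le hL hD.isName k
  set S : ℝ := (lengthBound ℓ k : ℝ) with hSdef
  have hS0 : 0 ≤ S := Nat.cast_nonneg _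
  set pt : ℕ → Plane := fun i =>
    WithLp.toLp 2 fun d => (gridCoord d (l.getD i 0) : ℝ) / 4 ^ k - B with hpt
  have hptd : ∀ i d, pt i d = (gridCoord d (l.getD i 0) : ℝ) / 4 ^ k - B := fun _ _ => rfl
  have hstep1 : ∀ i < 2 ^ k, dist (pt i) (pt (i + 1)) ≤ (S + 2) / 4 ^ k := by
    intro i hi
    refine dist_le_of_sq_add_sq_le (by positivity) ?_
    have h := hstep i hi
    rw [← Nat.cast_le (α := ℝ)] at h
    push_cast at h
    rw [cast_nat_dist, cast_nat_dist, sq_abs, sq_abs] at h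
    rw [hptd, hptd, hptd, hptd, sub_sub_sub_cancel_right, sub_sub_sub_cancel_right, ← sub_div,
      ← sub_div, div_pow, div_pow, div_pow, ← add_div]
    gcongr
    exact h
  have hsteps : ∀ i j, i ≤ j → j ≤ 2 ^ k →
      dist (pt i) (pt j) ≤ ((j : ℝ) - i) * ((S + 2) / 4 ^ k) := by
    intro i j hij
    induction j, hij using Nat.le_induction with
    | base => intro _; simp
    | succ j hij ih =>
      intro hj
      have h1 := ih (by omega)
      have h2 := hstep1 j (by omega)
      have h3 := dist_triangle (pt i) (pt j) (pt (j + 1))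
      push_cast
      linarith
  have hspeed : (S + 2) / 4 ^ k ≤ (L + 5 / 2 ^ k) / 2 ^ k := by
    rw [h42, ← div_div]
    gcongr
    rw [div_le_iff₀ h2, add_mul, div_mul_cancel₀ _ h2.ne']
    linarith
  have h52 : 5 / (2 : ℝ) ^ k ≤ 5 := div_le_self (by norm_num) h21
  refine ⟨fun s t => ?_, fun t => ?_, fun s => ?_, ?_⟩
  · wlog hst : s ≤ t generalizing s t
    · rw [dist_comm, abs_sub_comm]; exact this t s (le_of_not_ge hst)
    have hst' : (s : ℝ) ≤ t := hst
    have hfl : ⌊(s : ℝ) * 2 ^ k⌋₊ ≤ ⌊(t : ℝ) * 2 ^ k⌋₊ := by gcongr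
    have h := hsteps _ _ hfl (floor_mul_two_pow_le k t)
    have h5 : ((⌊(t : ℝ) * 2 ^ k⌋₊ : ℝ) - ⌊(s : ℝ) * 2 ^ k⌋₊) ≤ ((t : ℝ) - s) * 2 ^ k + 1 := by
      have := Nat.floor_le (mul_nonneg t.2.1 h2.le)
      have := Nat.lt_floor_add_one ((s : ℝ) * 2 ^ k)
      linarith
    have hts : 0 ≤ (t : ℝ) - s := sub_nonneg.2 hst'
    rw [abs_sub_comm, abs_of_nonneg hts]
    calc dist (pt ⌊(s : ℝ) * 2 ^ k⌋₊) (pt ⌊(t : ℝ) * 2 ^ k⌋₊)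
        ≤ (((t : ℝ) - s) * 2 ^ k + 1) * ((L + 5 / 2 ^ k) / 2 ^ k) := by
          refine h.trans ?_
          gcongr
      _ = (L + 5 / 2 ^ k) * (t - s) + (L + 5 / 2 ^ k) / 2 ^ k := by field_simp
      _ ≤ _ := by
          gcongr
          all_goals linarith
  · have hi := floor_mul_two_pow_le k t
    have hm : l.getD ⌊(t : ℝ) * 2 ^ k⌋₊ 0 ∈ l := by
      rw [List.getD_eq_getElem _ _ (by omega)]
      exact List.getElem_mem _
    obtain ⟨s, hs⟩ := hD.near _ _ (hmem _ hm)
    refine ⟨s, ?_⟩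
    have : ∀ d, |pathOfList B k l t d - g s d| ≤ 5 / 4 ^ k := by
      intro d
      rw [pathOfList_apply, abs_sub_comm, le_div_iff₀ h4, ← abs_of_pos h4, ← abs_mul, abs_of_pos h4]
      refine le_trans (le_of_eq ?_) (hs d)
      congr 1
      rw [two_pow_two_mul, ← h42]
      field_simp
      ring
    refine (dist_le_of_abs_coord_sub_le (by positivity) this).trans ?_
    calc 2 * (5 / (4 : ℝ) ^ k) = 10 / 2 ^ k / 2 ^ k := by rw [h42]; field_simp; norm_num
      _ ≤ 10 / 2 ^ k := div_le_self (by positivity) h21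
      _ ≤ _ := by gcongr; linarith
  · obtain ⟨i, hi, hi1, hi2⟩ := hcover _ (hD.mem (2 * k) s)
    have hi' : i ≤ 2 ^ k := Nat.le_of_lt_succ hi
    refine ⟨sampleTime k i, ?_⟩
    have hcoord : ∀ d, Nat.dist (gridCoord d (gridPoint B (2 * k) (g s)))
        (gridCoord d (l.getD i 0)) ≤ lengthBound ℓ k + 6 := by
      intro d
      fin_cases d
      · exact hi1
      · exact hi2
    have : ∀ d, |pathOfList B k l (sampleTime k i) d - g s d| ≤ (S + 7) / 4 ^ k := by
      intro d
      have h := hcoord d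
      rw [← Nat.cast_le (α := ℝ), cast_nat_dist, gridCoord_gridPoint] at h
      push_cast at h
      have h' := abs_floor_sub_le
        (mul_nonneg (hD.nonneg s d) (by positivity : (0 : ℝ) ≤ 2 ^ (2 * k)))
      rw [pathOfList_apply, floor_sampleTime hi', le_div_iff₀ h4, ← abs_of_pos h4, ← abs_mul,
        abs_of_pos h4]
      have he : ((gridCoord d (l.getD i 0) : ℝ) / 4 ^ k - B - g s d) * 4 ^ k =
          gridCoord d (l.getD i 0) - (g s d + B) * 2 ^ (2 * k) := by
        rw [two_pow_two_mul, ← h42]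
        field_simp
        ring
      rw [he]
      rw [abs_le] at h h' ⊢
      constructor <;> linarith [h.1, h.2, h'.1, h'.2]
    refine (dist_le_of_abs_coord_sub_le (by positivity) this).trans ?_
    rw [h42, ← div_div, ← mul_div_assoc]
    gcongr
    rw [← mul_div_assoc, div_le_iff₀ h2]
    nlinarith
  · have h0 : ⌊((0 : I) : ℝ) * 2 ^ k⌋₊ = 0 := by simp
    have h1 : ⌊((1 : I) : ℝ) * 2 ^ k⌋₊ = 2 ^ k := by
      have : ((1 : I) : ℝ) * 2 ^ k = ((2 ^ k : ℕ) : ℝ) := by simp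
      rw [this, Nat.floor_natCast]
    rw [pathOfList_apply, pathOfList_apply, h0, h1]
    have : (gridCoord c (l.getD 0 0) : ℝ) / 4 ^ k ≤
        (gridCoord c (l.getD (2 ^ k) 0) : ℝ) / 4 ^ k := by
      gcongr
    have : 0 ≤ (2 * L + 30) / 2 ^ k := by positivity
    linarith

/-! ### Correctness of the machine -/

theorem abs_index_sub_le {x : I} {α : ℕ → RatCode} (hα : IsName α x) (j : ℕ) :
    |((min (floorCode 0 (j + 1) (α j)) (2 ^ (j + 1)) : ℕ) : ℝ) - x * 2 ^ (j + 1)| ≤ 3 := by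
  have h2 : (0 : ℝ) < 2 ^ (j + 1) := by positivity
  have h := mul_le_mul_of_nonneg_right (hα j) h2.le
  rw [← abs_of_pos h2, ← abs_mul, abs_of_pos h2, sub_mul, pow_succ, ← mul_assoc (1 / _),
    one_div, inv_mul_cancel₀ (by positivity), one_mul, ← pow_succ, abs_le] at h
  have hx0 : 0 ≤ (x : ℝ) * 2 ^ (j + 1) := mul_nonneg x.2.1 h2.le
  have hx1 : (x : ℝ) * 2 ^ (j + 1) ≤ 2 ^ (j + 1) := mul_le_of_le_one_left h2.le x.2.2
  rw [floorCode_eq, Nat.cast_zero, add_zero]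
  have hlt := Nat.lt_floor_add_one (RatCode.val (α j) * 2 ^ (j + 1))
  have hle : (⌊RatCode.val (α j) * 2 ^ (j + 1)⌋₊ : ℝ) ≤ x * 2 ^ (j + 1) + 2 := by
    rcases le_total 0 (RatCode.val (α j) * 2 ^ (j + 1)) with h0 | h0
    · linarith [Nat.floor_le h0, h.2]
    · rw [Nat.floor_of_nonpos h0, Nat.cast_zero]
      linarith
  push_cast
  rw [abs_le]
  rcases min_cases (⌊RatCode.val (α j) * 2 ^ (j + 1)⌋₊ : ℝ) ((2 : ℝ) ^ (j + 1)) with hm | hm <;>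
    rw [hm.1] <;> constructor <;> linarith [h.1, h.2, hm.2]

theorem answer_eq_some_iff {d : Fin 2} {B k S i n : ℕ} {P : List (List (ℕ × ℕ))} {q : RatCode} :
    answer d B k S i n P = some q ↔ ∃ p, P.head? = some p ∧ (∀ p' ∈ P, Agree d k S i n p p') ∧
      q = gridCode B k (gridCoord d (p.getD i 0)) := by
  simp only [answer, Option.bind_eq_some_iff, Option.ite_none_right_eq_some, Option.some.injEq,
    eq_comm (b := q)]

theorem arcMachine_name_zero (c d : Fin 2) (B : ℕ) (G : ℕ → List (ℕ × ℕ)) (ℓ α : ℕ → RatCode)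
    (n : ℕ) : arcMachine c d B G ℓ ((List.range 0).map α) n = none := rfl

theorem arcMachine_name_succ (c d : Fin 2) (B : ℕ) (G : ℕ → List (ℕ × ℕ)) (ℓ α : ℕ → RatCode)
    (j n : ℕ) : arcMachine c d B G ℓ ((List.range (j + 1)).map α) n =
      answer d B (j + 1) (lengthBound ℓ (j + 1)) (min (floorCode 0 (j + 1) (α j)) (2 ^ (j + 1))) n
        (candidates c (2 ^ (j + 1)) (lengthBound ℓ (j + 1)) (G (2 * (j + 1)))) := by
  have h1 : ((List.range (j + 1)).map α).reverse.head? = some (α j) := by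
    simp [List.range_succ]
  have h2 : ((List.range (j + 1)).map α).length = j + 1 := by simp
  rw [arcMachine, h1, h2]
  rfl

section Correctness

variable {g : I → Plane} {L : ℝ} {c : Fin 2} {B : ℕ} {G : ℕ → List (ℕ × ℕ)} {ℓ : ℕ → RatCode}

/-- Every output of the machine is correct, because the paths which had to agree include the
sampling of the constant-speed parametrization. -/
theorem arcMachine_sound (hL : 0 ≤ L) (hg : HasConstantSpeed g L) (hgc : g 0 c ≤ g 1 c)
    (hD : IsArcData g L B G ℓ) (d : Fin 2) {x : I} {α : ℕ → RatCode} (hα : IsName α x) {k n : ℕ}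
    {q : RatCode} (h : arcMachine c d B G ℓ ((List.range k).map α) n = some q) :
    |RatCode.val q - g x d| ≤ 1 / 2 ^ n := by
  rcases k with _ | j
  · rw [arcMachine_name_zero] at h
    exact absurd h (by simp)
  rw [arcMachine_name_succ] at h
  obtain ⟨p, -, hall, rfl⟩ := answer_eq_some_iff.1 h
  have hidx := abs_index_sub_le hα j
  set k := j + 1 with hk
  set i := min (floorCode 0 k (α j)) (2 ^ k) with hi
  have hik : i ≤ 2 ^ k := min_le_right _ _
  have hag := hall _ (sampling_mem_candidates hL hg hgc hD k)
  rw [Agree, sampling_getD g B hik, gridCoord_gridPoint, ← Nat.cast_le (α := ℝ)] at hag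
  push_cast at hag
  rw [cast_nat_dist] at hag
  have h2 : (0 : ℝ) < 2 ^ k := by positivity
  have h4 : (0 : ℝ) < 4 ^ k := by positivity
  have h42 : (4 : ℝ) ^ k = 2 ^ k * 2 ^ k := four_pow_eq k
  have hn : (0 : ℝ) < 2 ^ n := by positivity
  have hfl := abs_floor_sub_le (mul_nonneg (hD.nonneg (sampleTime k i) d)
    (by positivity : (0 : ℝ) ≤ 2 ^ (2 * k)))
  have hS := le_lengthBound hD.isName k
  have hd : |(g (sampleTime k i) d + B) * 2 ^ (2 * k) - (g x d + B) * 2 ^ (2 * k)| ≤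
      3 * lengthBound ℓ k := by
    rw [← sub_mul, abs_mul, abs_of_pos (by positivity : (0 : ℝ) < 2 ^ (2 * k)),
      add_sub_add_right_eq_sub]
    have h1 := (abs_coord_sub_le_dist (g (sampleTime k i)) (g x) d).trans
      (hg.dist_le hL (sampleTime k i) x)
    have h3 : |(sampleTime k i : ℝ) - x| * 2 ^ k ≤ 3 := by
      rw [coe_sampleTime hik, ← abs_of_pos h2, ← abs_mul, abs_of_pos h2, sub_mul,
        div_mul_cancel₀ _ h2.ne']
      exact hidx
    calc |g (sampleTime k i) d - g x d| * 2 ^ (2 * k)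
        ≤ L * |(sampleTime k i : ℝ) - x| * 2 ^ (2 * k) := by gcongr
      _ = (L * 2 ^ k) * (|(sampleTime k i : ℝ) - x| * 2 ^ k) := by rw [two_pow_two_mul]; ring
      _ ≤ (L * 2 ^ k) * 3 := by gcongr
      _ ≤ 3 * lengthBound ℓ k := by linarith
  have htot : |(gridCoord d (p.getD i 0) : ℝ) - (g x d + B) * 2 ^ (2 * k)| ≤ 4 ^ k / 2 ^ n := by
    have hag' := (le_div_iff₀ hn).2 hag
    have t1 := abs_sub_le (gridCoord d (p.getD i 0) : ℝ)
      (⌊(g (sampleTime k i) d + B) * 2 ^ (2 * k)⌋₊ : ℝ) ((g x d + B) * 2 ^ (2 * k))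
    have t2 := abs_sub_le (⌊(g (sampleTime k i) d + B) * 2 ^ (2 * k)⌋₊ : ℝ)
      ((g (sampleTime k i) d + B) * 2 ^ (2 * k)) ((g x d + B) * 2 ^ (2 * k))
    linarith
  have he : RatCode.val (gridCode B k (gridCoord d (p.getD i 0))) - g x d =
      ((gridCoord d (p.getD i 0) : ℝ) - (g x d + B) * 2 ^ (2 * k)) / 4 ^ k := by
    rw [val_gridCode, two_pow_two_mul, ← h42]
    field_simp
    ring
  rw [he, abs_div, abs_of_pos h4, div_le_iff₀ h4]
  exact htot.trans_eq (by ring)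

theorem exists_pow_gt (a : ℝ) : ∃ k : ℕ, ∀ m ≥ k, a < 2 ^ m := by
  obtain ⟨k, hk⟩ := pow_unbounded_of_one_lt a (by norm_num : (1 : ℝ) < 2)
  exact ⟨k, fun m hm => hk.trans_le (pow_le_pow_right₀ (by norm_num) hm)⟩

/-- The machine eventually answers, because by compactness all candidate paths are uniformly close
to the constant-speed parametrization at a late stage. -/
theorem arcMachine_complete (hL : 0 < L) (hg : HasConstantSpeed g L)
    (hgi : Function.Injective g) (hgc : g 0 c < g 1 c) (hD : IsArcData g L B G ℓ) (d : Fin 2)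
    (α : ℕ → RatCode) (n : ℕ) :
    ∃ k q, arcMachine c d B G ℓ ((List.range k).map α) n = some q := by
  have hn : (0 : ℝ) < 2 ^ n := by positivity
  obtain ⟨η, hη, hclose⟩ := exists_forall_isNearParametrization hL hg hgi hgc
    (ε := 1 / (4 * 2 ^ n)) (by positivity)
  obtain ⟨k₁, hk₁⟩ := exists_pow_gt ((2 * L + 30) / η)
  obtain ⟨k₂, hk₂⟩ := exists_pow_gt (2 * ((3 * L + 10) * 2 ^ n))
  refine ⟨max k₁ k₂ + 1, ?_⟩
  rw [arcMachine_name_succ]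
  set k := max k₁ k₂ + 1 with hk
  set i := min (floorCode 0 k (α (max k₁ k₂))) (2 ^ k) with hi
  have hik : i ≤ 2 ^ k := min_le_right _ _
  have h2 : (0 : ℝ) < 2 ^ k := by positivity
  have h21 : (1 : ℝ) ≤ 2 ^ k := one_le_pow₀ (by norm_num)
  have h4 : (0 : ℝ) < 4 ^ k := by positivity
  have h42 : (4 : ℝ) ^ k = 2 ^ k * 2 ^ k := four_pow_eq k
  have hηk : (2 * L + 30) / 2 ^ k ≤ η := by
    rw [div_le_iff₀ h2, ← div_le_iff₀' hη]
    exact (hk₁ k (by omega)).le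
  have hk₂' := hk₂ k (by omega)
  have hS := lengthBound_le hL.le hD.isName k
  -- candidate paths at this stage are `1 / (4 * 2 ^ n)`-close to the arc at the sample time
  have hnear : ∀ p ∈ candidates c (2 ^ k) (lengthBound ℓ k) (G (2 * k)),
      |((gridCoord d (p.getD i 0) : ℝ) / 4 ^ k - B) - g (sampleTime k i) d| ≤
        1 / (4 * 2 ^ n) := by
    intro p hp
    have h := isNearParametrization_of_mem_candidates hL.le hD hp
    have h' : IsNearParametrization g L c η (pathOfList B k p) := by
      refine ⟨fun s t => (h.dist_le s t).trans (by gcongr), fun t => ?_, fun s => ?_,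
        h.forward.trans (by gcongr)⟩
      · obtain ⟨s, hs⟩ := h.near_range t
        exact ⟨s, hs.trans hηk⟩
      · obtain ⟨t, ht⟩ := h.range_near s
        exact ⟨t, ht.trans hηk⟩
    have := (abs_coord_sub_le_dist _ _ d).trans (hclose _ h' (sampleTime k i))
    rwa [pathOfList_apply, floor_sampleTime hik] at this
  have hne := sampling_mem_candidates hL.le hg hgc.le hD k
  obtain ⟨p, P, hP⟩ := List.exists_cons_of_ne_nil (List.ne_nil_of_mem hne)
  refine ⟨_, answer_eq_some_iff.2 ⟨p, by rw [hP]; rfl, fun q hq => ?_, rfl⟩⟩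
  have hp := hnear p (by rw [hP]; exact List.mem_cons_self)
  have hq := hnear q hq
  rw [Agree, ← Nat.cast_le (α := ℝ)]
  push_cast
  rw [cast_nat_dist]
  have hpq : |(gridCoord d (p.getD i 0) : ℝ) - gridCoord d (q.getD i 0)| ≤
      4 ^ k / (2 * 2 ^ n) := by
    have h1 : |(gridCoord d (p.getD i 0) : ℝ) / 4 ^ k - gridCoord d (q.getD i 0) / 4 ^ k| ≤
        1 / (2 * 2 ^ n) := by
      have he : 1 / (2 * 2 ^ n) = 1 / (4 * 2 ^ n) + 1 / (4 * (2 : ℝ) ^ n) := by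
        field_simp; norm_num
      rw [he]
      rw [abs_le] at hp hq ⊢
      constructor <;> linarith [hp.1, hp.2, hq.1, hq.2]
    rw [← sub_div, abs_div, abs_of_pos h4, div_le_iff₀ h4] at h1
    exact h1.trans_eq (by ring)
  have h3S : (3 * (lengthBound ℓ k : ℝ) + 1) * 2 ^ n ≤ 4 ^ k / 2 := by
    calc (3 * (lengthBound ℓ k : ℝ) + 1) * 2 ^ n ≤ ((3 * L + 10) * 2 ^ k) * 2 ^ n := by
          gcongr
          linarith
      _ = (2 * ((3 * L + 10) * 2 ^ n)) * 2 ^ k / 2 := by ring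
      _ ≤ 2 ^ k * 2 ^ k / 2 := by gcongr
      _ = 4 ^ k / 2 := by rw [h42]
  calc _ ≤ (4 ^ k / (2 * 2 ^ n) + (3 * (lengthBound ℓ k : ℝ) + 1)) * 2 ^ n := by gcongr
    _ = 4 ^ k / 2 + (3 * (lengthBound ℓ k : ℝ) + 1) * 2 ^ n := by field_simp
    _ ≤ 4 ^ k := by linarith

theorem isComputablePlaneFun_of_isArcData (hL : 0 < L) (hg : HasConstantSpeed g L)
    (hgi : Function.Injective g) (hgc : g 0 c < g 1 c) (hD : IsArcData g L B G ℓ)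
    (hG : Computable G) (hℓ : Computable ℓ) : IsComputablePlaneFun g := by
  classical
  intro d
  refine ⟨arcMachine c d B G ℓ, computable_arcMachine c d B hG hℓ, fun x α hα => ?_⟩
  have hprod : ∀ n, ∃ q, |RatCode.val q - g x d| ≤ 1 / 2 ^ n ∧
      Produces (arcMachine c d B G ℓ) α n q := by
    intro n
    have hex : ∃ k, (arcMachine c d B G ℓ ((List.range k).map α) n).isSome := by
      obtain ⟨k, q, hq⟩ := arcMachine_complete hL hg hgi hgc hD d α n
      exact ⟨k, by rw [hq]; rfl⟩
    obtain ⟨q, hq⟩ := Option.isSome_iff_exists.1 (Nat.find_spec hex)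
    refine ⟨q, arcMachine_sound hL.le hg hgc.le hD d hα hq, Nat.find hex, hq, fun j hj => ?_⟩
    exact Option.not_isSome_iff_eq_none.1 (Nat.find_min hex hj)
  choose β hβ using hprod
  exact ⟨β, fun n => (hβ n).1, fun n => (hβ n).2⟩

end Correctness

/-! ### Grid points from square neighbourhoods -/

theorem nat_dist_floor_le {x y r M : ℝ} (hx : 0 ≤ x * M) (hy : 0 ≤ y * M) (hM : 0 < M)
    (h : |x - y| < r) : Nat.dist ⌊x * M⌋₊ ⌊y * M⌋₊ ≤ ⌊r * M⌋₊ + 2 := by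
  rw [← Nat.cast_le (α := ℝ), cast_nat_dist]
  have h1 := abs_floor_sub_floor_le hx hy
  have h2 : |x * M - y * M| ≤ r * M := by
    rw [← sub_mul, abs_mul, abs_of_pos hM]
    gcongr
  have h3 := Nat.lt_floor_add_one (r * M)
  push_cast
  linarith

/-- A grid coordinate accepted by the test of `gridCover` is within four units of a point of the
open interval of radius `r` around `y - B`. -/
theorem exists_near_of_nat_dist_le {y r M B : ℝ} {a : ℕ} (hy : 0 ≤ (y + B) * M) (hM : 0 < M)
    (hr : 0 < r) (h : Nat.dist a ⌊(y + B) * M⌋₊ ≤ ⌊r * M⌋₊ + 2) :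
    ∃ w, |w - y| < r ∧ |(w + B) * M - a| ≤ 4 := by
  rw [← Nat.cast_le (α := ℝ), cast_nat_dist] at h
  push_cast at h
  have hρ : 0 < r * M := mul_pos hr hM
  have h1 := Nat.floor_le hρ.le
  have h2 := abs_floor_sub_le hy
  have hD : |(a : ℝ) - (y + B) * M| ≤ r * M + 3 := by
    have := abs_sub_le (a : ℝ) (⌊(y + B) * M⌋₊ : ℝ) ((y + B) * M)
    linarith
  set D := (a : ℝ) - (y + B) * M with hDdef
  -- shrink the offset from the centre by the factor which turns `r * M + 4` into `r * M`
  refine ⟨y + r * D / (r * M + 4), ?_, ?_⟩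
  · rw [add_sub_cancel_left, abs_div, abs_mul, abs_of_pos hr,
      abs_of_pos (by linarith : (0 : ℝ) < r * M + 4), div_lt_iff₀ (by linarith)]
    exact mul_lt_mul_of_pos_left (by linarith) hr
  · have he : (y + r * D / (r * M + 4) + B) * M - a = -(4 * D / (r * M + 4)) := by
      have : (r * M + 4) ≠ 0 := by positivity
      field_simp
      rw [hDdef]
      ring
    rw [he, abs_neg, abs_div, abs_mul, abs_of_pos (by linarith : (0 : ℝ) < r * M + 4),
      div_le_iff₀ (by linarith), abs_of_pos (by norm_num : (0 : ℝ) < 4)]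
    linarith

theorem mem_gridCover {B m : ℕ} {Q : List NhdCode} {a : ℕ × ℕ} :
    a ∈ gridCover B m Q ↔ (a.1 ≤ 2 * B * 2 ^ m ∧ a.2 ≤ 2 * B * 2 ^ m) ∧
      ∃ c ∈ Q, Nat.dist a.1 (floorCode B m c.1.1) ≤ floorCode 0 m c.2 + 2 ∧
        Nat.dist a.2 (floorCode B m c.1.2) ≤ floorCode 0 m c.2 + 2 := by
  rcases a with ⟨i, j⟩
  simp [gridCover]

theorem exists_near_of_hausdorffDistance_lt {A C : Set Plane} {δ : ℝ} (hδ : 0 < δ)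
    (h : hausdorffDistance A C < ENNReal.ofReal δ) {w : Plane} (hw : w ∈ A) :
    ∃ z ∈ C, ∀ d, |w d - z d| < δ := by
  simp only [hausdorffDistance, iInf_lt_iff] at h
  obtain ⟨ε, ⟨-, hAC, -⟩, hεδ⟩ := h
  have hεδ' : ε < δ := (ENNReal.ofReal_lt_ofReal_iff hδ).1 hεδ
  obtain ⟨z, hz, hwz⟩ := mem_iUnion₂.1 (hAC hw)
  refine ⟨z, hz, fun d => ?_⟩
  fin_cases d
  · exact hwz.1.trans hεδ'
  · exact hwz.2.trans hεδ'

theorem KComputable.exists_isArcData {g : I → Plane} (hg : Continuous g)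
    (hK : KComputable (range g)) {L : ℝ} {ℓ : ℕ → RatCode} (hℓ : IsName ℓ L) :
    ∃ (B : ℕ) (G : ℕ → List (ℕ × ℕ)), Computable G ∧ IsArcData g L B G ℓ := by
  obtain ⟨Q, hQ, hcover⟩ := hK
  obtain ⟨R, hR⟩ := isCompact_univ.exists_bound_of_continuousOn hg.continuousOn
  have hR' : ∀ t d, |g t d| ≤ R := fun t d => by
    have h1 := abs_coord_sub_le_dist (g t) 0 d
    rw [dist_zero_right] at h1
    have h2 : |g t d| ≤ ‖g t‖ := by simpa using h1
    exact h2.trans (hR t (mem_univ _))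
  set B : ℕ := ⌈R⌉₊ + 1 with hB
  have hBR : R + 1 ≤ B := by
    rw [hB]
    push_cast
    linarith [Nat.le_ceil R]
  have hpos : ∀ t d, 0 ≤ g t d + B := fun t d => by linarith [(abs_le.1 (hR' t d)).1]
  refine ⟨B, fun m => gridCover B m (Q m),
    (primrec_gridCover B).to_comp.comp Computable.id hQ, hpos, fun m a ha => ?_, fun m t => ?_, hℓ⟩
  all_goals
    have hM : (0 : ℝ) < 2 ^ m := by positivity
    have hM1 : 1 / (2 : ℝ) ^ m ≤ 1 := (div_le_one hM).2 (one_le_pow₀ (by norm_num))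
    obtain ⟨hr, hsub, hdist⟩ := hcover m
    have hnear := fun w (hw : w ∈ coverUnion (Q m)) =>
      exists_near_of_hausdorffDistance_lt (by positivity) hdist hw
    have hcenter : ∀ c ∈ Q m, 0 ≤ (RatCode.val c.1.1 + B) * 2 ^ m ∧
        0 ≤ (RatCode.val c.1.2 + B) * 2 ^ m := by
      intro c hc
      obtain ⟨-, ⟨s, rfl⟩, hs⟩ := hnear !₂[RatCode.val c.1.1, RatCode.val c.1.2]
        (mem_iUnion₂.2 ⟨c, hc, by simpa [NhdCode.nhd, squareNhd] using hr c hc⟩)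
      have h0 := (abs_lt.1 (hs 0)).1
      have h1 := (abs_lt.1 (hs 1)).1
      simp only [Matrix.cons_val_zero, Matrix.cons_val_one] at h0 h1
      constructor <;> refine mul_nonneg ?_ hM.le
      · linarith [(abs_le.1 (hR' s 0)).1]
      · linarith [(abs_le.1 (hR' s 1)).1]
  · obtain ⟨-, c, hc, h0, h1⟩ := mem_gridCover.1 ha
    rw [floorCode_eq, floorCode_eq, Nat.cast_zero, add_zero] at h0 h1
    obtain ⟨w₀, hw₀, ha₀⟩ := exists_near_of_nat_dist_le (hcenter c hc).1 hM (hr c hc) h0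
    obtain ⟨w₁, hw₁, ha₁⟩ := exists_near_of_nat_dist_le (hcenter c hc).2 hM (hr c hc) h1
    obtain ⟨-, ⟨s, rfl⟩, hs⟩ := hnear !₂[w₀, w₁]
      (mem_iUnion₂.2 ⟨c, hc, by simpa [NhdCode.nhd, squareNhd] using ⟨hw₀, hw₁⟩⟩)
    have key : ∀ (w : ℝ) (d : Fin 2) (b : ℕ), |w - g s d| < 1 / 2 ^ m →
        |(w + B) * 2 ^ m - b| ≤ 4 → |(g s d + B) * 2 ^ m - b| ≤ 5 := by
      intro w d b hw hb
      have h1 : |(g s d + B) * 2 ^ m - (w + B) * 2 ^ m| ≤ 1 := by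
        rw [← sub_mul, add_sub_add_right_eq_sub, abs_mul, abs_of_pos hM, abs_sub_comm]
        exact ((lt_div_iff₀ hM).1 hw).le
      have := abs_sub_le ((g s d + B) * 2 ^ m) ((w + B) * 2 ^ m) b
      linarith
    refine ⟨s, fun d => ?_⟩
    fin_cases d
    · exact key w₀ 0 a.1 (by simpa using hs 0) ha₀
    · exact key w₁ 1 a.2 (by simpa using hs 1) ha₁
  · obtain ⟨c, hc, hsq⟩ := mem_iUnion₂.1 (hsub (mem_range_self t))
    have hle : ∀ d, ⌊(g t d + B) * 2 ^ m⌋₊ ≤ 2 * B * 2 ^ m := by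
      intro d
      refine Nat.floor_le_of_le ?_
      push_cast
      gcongr
      linarith [(abs_le.1 (hR' t d)).2]
    refine mem_gridCover.2 ⟨⟨hle 0, hle 1⟩, c, hc, ?_⟩
    rw [floorCode_eq, floorCode_eq, floorCode_eq, Nat.cast_zero, add_zero]
    refine ⟨nat_dist_floor_le (mul_nonneg (hpos t 0) hM.le) (hcenter c hc).1 hM ?_,
      nat_dist_floor_le (mul_nonneg (hpos t 1) hM.le) (hcenter c hc).2 hM ?_⟩
    · rw [add_sub_add_right_eq_sub]; simpa using hsq.1
    · rw [add_sub_add_right_eq_sub]; simpa using hsq.2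

/-- The constant-speed parametrization can be traversed so that some coordinate has a larger value
at the end than at the start. -/
theorem exists_hasConstantSpeed_of_isSimpleCurve {C : Set Plane} (hC : IsSimpleCurve C)
    (hfin : curveLength C ≠ ⊤) :
    ∃ (g : I → Plane) (c : Fin 2), Function.Injective g ∧ range g = C ∧
      0 < (curveLength C).toReal ∧ HasConstantSpeed g (curveLength C).toReal ∧ g 0 c < g 1 c := by
  obtain ⟨f, hf, hfi⟩ := hC
  rw [curveLength_eq hf hfi] at hfin ⊢
  obtain ⟨g, hgi, hgr, hL, hg⟩ := exists_hasConstantSpeed hf.1 hfi hfin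
  rw [hf.2] at hgr
  obtain ⟨c, hc⟩ : ∃ c, g 0 c ≠ g 1 c := by
    by_contra! h
    exact zero_ne_one (hgi (PiLp.ext h))
  rcases lt_or_gt_of_ne hc with hlt | hgt
  · exact ⟨g, c, hgi, hgr, hL, hg, hlt⟩
  · refine ⟨g ∘ σ, c, hgi.comp symm_bijective.injective, ?_, hL, hg.comp_symm, by simpa using hgt⟩
    rw [symm_bijective.surjective.range_comp, hgr]

end ComputableCurve

theorem theorem2p4 (C : Set ComputableCurve.Plane)
    (hC : ComputableCurve.IsSimpleCurve C)
    (hK : ComputableCurve.KComputable C)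
    (hL : ComputableCurve.HasComputableLength C) :
    ComputableCurve.NComputable C := by
  obtain ⟨hfin, ℓ, hℓ, hname⟩ := hL
  obtain ⟨g, c, hgi, rfl, hpos, hg, hgc⟩ :=
    ComputableCurve.exists_hasConstantSpeed_of_isSimpleCurve hC hfin
  have hcont := hg.continuous hpos.le
  obtain ⟨B, G, hG, hD⟩ := hK.exists_isArcData hcont hname
  refine ⟨hfin, g, ⟨hcont, rfl⟩,
    ComputableCurve.isComputablePlaneFun_of_isArcData hpos hg hgi hgc hD hG hℓ, fun t => ?_⟩
  rw [hg.curveLength_image hpos.le hgi t, ENNReal.ofReal_mul hpos.le, ENNReal.ofReal_toReal hfin,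
    mul_comm]
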